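/- Let $M$ be a smooth $N$-dimensional manifold with a smooth Riemannian metric $S=\sqrt{a_{ij}(x)y^iy^j}$ and a smooth 1-form $b=b_i(x)y^i$ of unit Riemannian length, $a^{ij}b_ib_j=1$, and let $g$ be a constant with $-2<g<2$. In local coordinates put $b^i=a^{ij}b_j$, $q=\sqrt{(a_{ij}-b_ib_j)y^iy^j}=\sqrt{S^2-b^2}$, $v^i=y^i-b\,b^i$, $h=\sqrt{1-g^2/4}$, $G=g/h$, $L=q+\tfrac g2 b$, and let $$K=\sqrt{b^2+gqb+q^2}\;e^{\frac12 G\Phi},\qquad \Phi=\pm\frac{\pi}{2}+\arctan\frac G2-\arctan\frac{L}{hb},$$ with the sign $+$ for $b>0$ and $-$ for $b<0$, and $\Phi=\arctan\frac G2$ (the common limit) for $b=0$, be the Finsleroid–Finsler metric function with constant charge $g$. Let $g_{ij}=\frac12\,\partial^2K^2/\partial y^i\partial y^j$, let $(g^{ij})$ be the inverse matrix, and let $\gamma^k{}_{ij}=\frac12 g^{kn}\left(\frac{\partial g_{ni}}{\partial x^j}+\frac{\partial g_{nj}}{\partial x^i}-\frac{\partial g_{ji}}{\partial x^n}\right)$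 be the Finslerian Christoffel symbols. Let $\nabla$ and $a^i{}_{km}$ be the covariant derivative and the Christoffel symbols of the Riemannian metric $a_{ij}$, let $f_{mn}=\nabla_mb_n-\nabla_nb_m$, $f^i{}_n=a^{ik}f_{kn}$ and $f^i=f^i{}_n y^n$. No further condition is imposed on $b$. Then in every local coordinate system, at every $(x,y)$ with $q(x,y)>0$ (that is, $y$ is not a multiple of the vector $b^i(x)$), the function $K$ is $C^\infty$ near $(x,y)$, the matrix $(g_{ij})$ is invertible, and the geodesic spray coefficients $G^i=\gamma^i{}_{nm}y^ny^m$ are $$G^i=g\left(\frac1q\,y^jy^h\nabla_jb_h+g\,y^hb^j\nabla_jb_h\right)v^i-g\,q\,f^i+a^i{}_{km}y^ky^m .$$ In other words, the spray has the form $$G^i=c_1\frac1q\,y^jy^h(\nabla_jb_h)\,v^i+c_2\,y^hb^j(\nabla_jb_h)\,v^i+c_3\,q\,f^i+a^i{}_{km}y^ky^m$$ with $c_1=g$, $c_2=g^2$, $c_3=-g$; the function $K$ itself does not appear on the right-hand side. -/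

import Mathlib

open scoped Manifold ContDiff Bundle
open Bundle

/-! ## Tensor calculus in a local coordinate system

A coordinate point `x` and the coordinate tuple `y = (y^i)` of a tangent vector at `x` are both
elements of `Coord N`. -/

/-- The coordinate space `ℝ^N`. -/
abbrev Coord (N : ℕ) : Type := EuclideanSpace ℝ (Fin N)

namespace Coord

variable {N : ℕ}

/-- The partial derivative of `f` with respect to the `i`-th coordinate, at `x`. -/
noncomputable def partialDeriv (i : Fin N) (f : Coord N → ℝ) (x : Coord N) : ℝ :=
  fderiv ℝ f x (EuclideanSpace.single i 1)

/-- The (Riemannian) Christoffel symbols `a^k_{ij} = ½ a^{kn} (∂_j a_{ni} + ∂_i a_{nj} - ∂_n a_{ji})`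
of a field of matrices `a = (a_{ij}(x))`. -/
noncomputable def riemannChristoffel (a : Coord N → Matrix (Fin N) (Fin N) ℝ) (x : Coord N)
    (k i j : Fin N) : ℝ :=
  1 / 2 * ∑ n, (a x)⁻¹ k n *
    (partialDeriv j (fun z => a z n i) x + partialDeriv i (fun z => a z n j) x
      - partialDeriv n (fun z => a z j i) x)

/-- The covariant derivative `∇_j b_h = ∂_j b_h - a^k_{jh} b_k` of a covector field `b`. -/
noncomputable def nabla (a : Coord N → Matrix (Fin N) (Fin N) ℝ) (b : Coord N → Fin N → ℝ)
    (x : Coord N) (j h : Fin N) : ℝ :=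
  partialDeriv j (fun z => b z h) x - ∑ k, riemannChristoffel a x k j h * b x k

/-- The curl `f_{mn} = ∇_m b_n - ∇_n b_m`. -/
noncomputable def curl (a : Coord N → Matrix (Fin N) (Fin N) ℝ) (b : Coord N → Fin N → ℝ)
    (x : Coord N) (m n : Fin N) : ℝ :=
  nabla a b x m n - nabla a b x n m

/-- `f^i_n = a^{ik} f_{kn}`. -/
noncomputable def curlUp (a : Coord N → Matrix (Fin N) (Fin N) ℝ) (b : Coord N → Fin N → ℝ)
    (x : Coord N) (i n : Fin N) : ℝ :=
  ∑ k, (a x)⁻¹ i k * curl a b x k n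

/-- `f^i = f^i_n y^n`. -/
noncomputable def curlVec (a : Coord N → Matrix (Fin N) (Fin N) ℝ) (b : Coord N → Fin N → ℝ)
    (x y : Coord N) (i : Fin N) : ℝ :=
  ∑ n, curlUp a b x i n * y n

/-- The contravariant components `b^i = a^{ij} b_j`. -/
noncomputable def raise (a : Coord N → Matrix (Fin N) (Fin N) ℝ) (b : Coord N → Fin N → ℝ)
    (x : Coord N) (i : Fin N) : ℝ :=
  ∑ j, (a x)⁻¹ i j * b x j

/-- The scalar `b = b_i y^i`. -/
def pairing (b : Coord N → Fin N → ℝ) (x y : Coord N) : ℝ :=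
  ∑ i, b x i * y i

/-- The scalar `q = √(r_{ij} y^i y^j)` with `r_{ij} = a_{ij} - b_i b_j`. -/
noncomputable def qScalar (a : Coord N → Matrix (Fin N) (Fin N) ℝ) (b : Coord N → Fin N → ℝ)
    (x y : Coord N) : ℝ :=
  Real.sqrt (∑ i, ∑ j, (a x i j - b x i * b x j) * y i * y j)

/-- The vector `v^i = y^i - b b^i`. -/
noncomputable def vVec (a : Coord N → Matrix (Fin N) (Fin N) ℝ) (b : Coord N → Fin N → ℝ)
    (x y : Coord N) (i : Fin N) : ℝ :=
  y i - pairing b x y * raise a b x i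

/-- The general spray coefficients
`c₁ (1/q) y^j y^h (∇_j b_h) v^i + c₂ y^h b^j (∇_j b_h) v^i + c₃ q f^i + a^i_{km} y^k y^m`,
where `c₁, c₂, c₃` are the values at `x` of the three scalars. -/
noncomputable def sprayForm (a : Coord N → Matrix (Fin N) (Fin N) ℝ) (b : Coord N → Fin N → ℝ)
    (c₁ c₂ c₃ : ℝ) (x y : Coord N) (i : Fin N) : ℝ :=
  c₁ * (1 / qScalar a b x y) * (∑ j, ∑ h, y j * y h * nabla a b x j h) * vVec a b x y i
    + c₂ * (∑ j, ∑ h, y h * raise a b x j * nabla a b x j h) * vVec a b x y i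
    + c₃ * qScalar a b x y * curlVec a b x y i
    + ∑ k, ∑ m, riemannChristoffel a x i k m * y k * y m

/-! ### Finsler geometry of a function `K(x, y)` in coordinates -/

/-- The Finslerian metric tensor `g_{ij} = ½ ∂²K² / ∂y^i ∂y^j`. -/
noncomputable def finslerMetric (K : Coord N → Coord N → ℝ) (x y : Coord N) :
    Matrix (Fin N) (Fin N) ℝ :=
  Matrix.of fun i j =>
    1 / 2 * partialDeriv i (fun w => partialDeriv j (fun z => K x z ^ 2) w) y

/-- `γ_{inj} = ½ (∂_j g_{ni} + ∂_i g_{nj} - ∂_n g_{ji})`, with `∂_j = ∂/∂x^j` at fixed `y`. -/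
noncomputable def finslerChristoffelLow (K : Coord N → Coord N → ℝ) (x y : Coord N)
    (i n j : Fin N) : ℝ :=
  1 / 2 * (partialDeriv j (fun z => finslerMetric K z y n i) x
    + partialDeriv i (fun z => finslerMetric K z y n j) x
    - partialDeriv n (fun z => finslerMetric K z y j i) x)

/-- The Finslerian Christoffel symbols `γ^k_{ij} = g^{kn} γ_{inj}`. -/
noncomputable def finslerChristoffel (K : Coord N → Coord N → ℝ) (x y : Coord N)
    (k i j : Fin N) : ℝ :=
  ∑ n, (finslerMetric K x y)⁻¹ k n * finslerChristoffelLow K x y i n j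

/-- The geodesic spray coefficients `G^i = γ^i_{nm} y^n y^m`. -/
noncomputable def finslerSpray (K : Coord N → Coord N → ℝ) (x y : Coord N) (i : Fin N) : ℝ :=
  ∑ n, ∑ m, finslerChristoffel K x y i n m * y n * y m

end Coord

/-! ## The Finsleroid–Finsler space -/

/-- The data of a Finsleroid–Finsler space on a smooth `N`-dimensional manifold `M`: a smooth
Riemannian metric `a`, a smooth 1-form `b` of unit Riemannian length, and a smooth scalar
`charge` (the Finsleroid charge `g(x)`) with values in `(-2, 2)`. The metric function `K` is
`FinsleroidFinslerSpace.K` below. -/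
structure FinsleroidFinslerSpace (N : ℕ) (M : Type*) [TopologicalSpace M]
    [ChartedSpace (Coord N) M] [IsManifold (𝓡 N) ∞ M] where
  /-- the associated Riemannian metric -/
  a : ContMDiffRiemannianMetric (𝓡 N) ∞ (Coord N) (fun p : M => TangentSpace (𝓡 N) p)
  /-- the 1-form -/
  b : ∀ p : M, TangentSpace (𝓡 N) p →L[ℝ] ℝ
  contMDiff_b : ContMDiff (𝓡 N) ((𝓡 N).prod 𝓘(ℝ, Coord N →L[ℝ] ℝ)) ∞
    (fun p => TotalSpace.mk' (Coord N →L[ℝ] ℝ)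
      (E := fun p : M => TangentSpace (𝓡 N) p →L[ℝ] Trivial M ℝ p) p (b p))
  /-- `a^{ij} b_i b_j = 1`: the vector `w` dual to `b` (i.e. `b^i`) satisfies `b(w) = 1` -/
  unit_b : ∀ p : M, ∃ w : TangentSpace (𝓡 N) p, (∀ v, a.inner p w v = b p v) ∧ b p w = 1
  /-- the Finsleroid charge `g(x)` -/
  charge : M → ℝ
  contMDiff_charge : ContMDiff (𝓡 N) 𝓘(ℝ, ℝ) ∞ charge
  charge_mem : ∀ p : M, charge p ∈ Set.Ioo (-2 : ℝ) 2

namespace FinsleroidFinslerSpace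

variable {N : ℕ} {M : Type*} [TopologicalSpace M] [ChartedSpace (Coord N) M]
  [IsManifold (𝓡 N) ∞ M]

/-- `q = √(S² - b²)` as a function of a tangent vector `v`. -/
noncomputable def q (F : FinsleroidFinslerSpace N M) (p : M) (v : TangentSpace (𝓡 N) p) : ℝ :=
  Real.sqrt (F.a.inner p v v - F.b p v ^ 2)

/-- `h = √(1 - g²/4)`. -/
noncomputable def h (F : FinsleroidFinslerSpace N M) (p : M) : ℝ :=
  Real.sqrt (1 - 1 / 4 * F.charge p ^ 2)

/-- `G = g / h`. -/
noncomputable def G (F : FinsleroidFinslerSpace N M) (p : M) : ℝ :=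
  F.charge p / F.h p

/-- The characteristic quadratic form `B = b² + g q b + q²`. -/
noncomputable def B (F : FinsleroidFinslerSpace N M) (p : M) (v : TangentSpace (𝓡 N) p) : ℝ :=
  F.b p v ^ 2 + F.charge p * F.q p v * F.b p v + F.q p v ^ 2

/-- `L = q + (g/2) b`. -/
noncomputable def L (F : FinsleroidFinslerSpace N M) (p : M) (v : TangentSpace (𝓡 N) p) : ℝ :=
  F.q p v + F.charge p / 2 * F.b p v

/-- `Φ = ± π/2 + arctan (G/2) - arctan (L/(h b))`, with sign `+` for `b > 0` and `-` for `b < 0`.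
At `b = 0` both expressions are read with `arctan (± ∞) = ± π/2`, which gives the common
one-sided limit `arctan (G/2)`. -/
noncomputable def Phi (F : FinsleroidFinslerSpace N M) (p : M) (v : TangentSpace (𝓡 N) p) : ℝ :=
  if 0 < F.b p v then
    Real.pi / 2 + Real.arctan (F.G p / 2) - Real.arctan (F.L p v / (F.h p * F.b p v))
  else if F.b p v < 0 then
    -(Real.pi / 2) + Real.arctan (F.G p / 2) - Real.arctan (F.L p v / (F.h p * F.b p v))
  else Real.arctan (F.G p / 2)

/-- The Finsleroid–Finsler metric function `K = √B · exp (½ G Φ)`. -/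
noncomputable def K (F : FinsleroidFinslerSpace N M) (p : M) (v : TangentSpace (𝓡 N) p) : ℝ :=
  Real.sqrt (F.B p v) * Real.exp (1 / 2 * F.G p * F.Phi p v)

/-! ### Components in a chart `e` -/

/-- The tangent vector `y^i ∂/∂x^i` at the point with coordinates `x` in the chart `e`. -/
noncomputable def coordVec (e : OpenPartialHomeomorph M (Coord N)) (x y : Coord N) :
    TangentSpace (𝓡 N) (e.symm x) :=
  mfderiv (𝓡 N) (𝓡 N) e.symm x y

/-- The components `a_{ij}(x)` of the Riemannian metric. -/
noncomputable def coordA (F : FinsleroidFinslerSpace N M) (e : OpenPartialHomeomorph M (Coord N))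
    (x : Coord N) : Matrix (Fin N) (Fin N) ℝ :=
  Matrix.of fun i j => F.a.inner (e.symm x)
    (coordVec e x (EuclideanSpace.single i 1)) (coordVec e x (EuclideanSpace.single j 1))

/-- The components `b_i(x)` of the 1-form. -/
noncomputable def coordB (F : FinsleroidFinslerSpace N M) (e : OpenPartialHomeomorph M (Coord N))
    (x : Coord N) (i : Fin N) : ℝ :=
  F.b (e.symm x) (coordVec e x (EuclideanSpace.single i 1))

/-- The metric function `K(x, y)` in coordinates. -/
noncomputable def coordK (F : FinsleroidFinslerSpace N M) (e : OpenPartialHomeomorph M (Coord N))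
    (x y : Coord N) : ℝ :=
  F.K (e.symm x) (coordVec e x y)

end FinsleroidFinslerSpace

/-! ## Components of the structure in a chart -/

namespace FinsleroidFinslerSpace

variable {N : ℕ} {M : Type*} [TopologicalSpace M] [ChartedSpace (Coord N) M]

/-! Everything rests on one differential identity. Since `q dq = ½ dS² - b db` and `d(e^{GΦ}) =
e^{GΦ} (g/B) (q db - b dq)`, the `dq` terms in `d(B e^{GΦ})` combine to give `dK² = e^{GΦ} (dS² + 2
g q db)` (`hasFDerivAt_energy`). It applies to variations of `x` and of `y` alike. In `y` it gives
the momentum `p_n = e^{GΦ} (a_{ni} y^i + g q b_n)`, and one more derivative gives `g_{ij}` in closed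
form.

Homogeneity, in the form `g_{ni} y^i = p_n` and `y^n p_n = K²`, turns the lowered spray into the
Euler–Lagrange expression `y^j ∂_j p_n - ½ ∂_n K²` (`sum_finslerChristoffelLow`). The matrix
`g_{ij}` is invertible (`isUnit_det_finslerMetric`), so it suffices to check that the claimed `G^i`
solves `g_{ni} G^i = y^j ∂_j p_n - ½ ∂_n K²` (`sum_finslerMetric_mul_sprayForm`).

The closed form of `g_{ni}` sees a vector `G` only through `a_{ni} G^i`, `y_i G^i` and `b_i G^i`.
Put `T = y^j y^h ∇_j b_h` and `s = y^h b^j ∇_j b_h`. Unit length gives `b^h ∇_j b_h = 0`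
(`sum_raise_mul_nabla`), hence `b_i v^i = 0` and `b_i f^i = s`. With the coefficients `g`, `g²`,
`-g`, both `T` and `s` cancel in `y_i G^i + g q b_i G^i` and in `a_{ni} G^i + (g/q) (b_i G^i) (y_n -
b b_n)`. What remains are ordinary derivatives of `a` and `b`, which match the right-hand side. -/

theorem mdifferentiable_of_mem_maximalAtlas {e : OpenPartialHomeomorph M (Coord N)}
    (he : e ∈ IsManifold.maximalAtlas (𝓡 N) ∞ M) : e.MDifferentiable (𝓡 N) (𝓡 N) :=
  ⟨(contMDiffOn_of_mem_maximalAtlas he).mdifferentiableOn (by simp),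
    (contMDiffOn_symm_of_mem_maximalAtlas he).mdifferentiableOn (by simp)⟩

theorem coordVec_eq_sum (e : OpenPartialHomeomorph M (Coord N)) (x y : Coord N) :
    coordVec e x y = ∑ i, y i • coordVec e x (EuclideanSpace.single i 1) := by
  unfold coordVec
  have hy : y = ∑ i, y i • EuclideanSpace.single i (1 : ℝ) := by
    ext j
    simp [Pi.single_apply]
  conv_lhs => rw [hy]
  exact (map_sum (mfderiv (𝓡 N) (𝓡 N) e.symm x) _ _).trans
    (Finset.sum_congr rfl fun i _ => map_smul (mfderiv (𝓡 N) (𝓡 N) e.symm x) _ _)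

variable [IsManifold (𝓡 N) ∞ M]

/-- Coordinate vectors with constant components form a smooth vector field along `e.symm`. -/
theorem contMDiffOn_coordVec {e : OpenPartialHomeomorph M (Coord N)}
    (he : e ∈ IsManifold.maximalAtlas (𝓡 N) ∞ M) (v : Coord N) :
    ContMDiffOn (𝓡 N) (𝓡 N).tangent ∞
      (fun z => (⟨e.symm z, coordVec e z v⟩ : TangentBundle (𝓡 N) M)) e.target := by
  have hs := (contMDiffOn_symm_of_mem_maximalAtlas he)
  have h1 := hs.contMDiffOn_tangentMapWithin (m := ∞) (by simp) e.open_target.uniqueMDiffOn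
  -- The field is the image of a constant section of the tangent bundle of the coordinate space
  -- under the tangent map of `e.symm`.
  have h2 : ContMDiff (𝓡 N) (𝓡 N).tangent ∞
      (fun z : Coord N => (⟨z, v⟩ : TangentBundle (𝓡 N) (Coord N))) := by
    intro z
    rw [contMDiffAt_totalSpace]
    refine ⟨contMDiffAt_id, ?_⟩
    simpa using contMDiffAt_const
  have h3 := h1.comp h2.contMDiffOn (s := e.target) (fun z hz => hz)
  refine h3.congr fun z hz => ?_
  simp only [Function.comp, tangentMapWithin, coordVec]
  rw [mfderivWithin_of_isOpen e.open_target hz]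

theorem contDiffOn_inner_coordVec (F : FinsleroidFinslerSpace N M)
    {e : OpenPartialHomeomorph M (Coord N)}
    (he : e ∈ IsManifold.maximalAtlas (𝓡 N) ∞ M) (v w : Coord N) :
    ContDiffOn ℝ ∞ (fun z => F.a.inner (e.symm z) (coordVec e z v) (coordVec e z w)) e.target := by
  have hs := (contMDiffOn_symm_of_mem_maximalAtlas he)
  have : ContMDiffOn (𝓡 N) ((𝓡 N).prod 𝓘(ℝ)) ∞
      (fun z ↦ TotalSpace.mk' ℝ (E := Bundle.Trivial M ℝ) (e.symm z)
        (F.a.inner (e.symm z) (coordVec e z v) (coordVec e z w))) e.target := by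
    apply ContMDiffOn.clm_bundle_apply₂ (F₁ := Coord N) (F₂ := Coord N)
    · exact F.a.contMDiff.comp_contMDiffOn hs
    · exact contMDiffOn_coordVec he v
    · exact contMDiffOn_coordVec he w
  rw [← contMDiffOn_iff_contDiffOn]
  intro z hz
  have := this z hz
  simp only [contMDiffWithinAt_totalSpace] at this
  exact this.2

theorem contDiffOn_b_coordVec (F : FinsleroidFinslerSpace N M)
    {e : OpenPartialHomeomorph M (Coord N)}
    (he : e ∈ IsManifold.maximalAtlas (𝓡 N) ∞ M) (v : Coord N) :
    ContDiffOn ℝ ∞ (fun z => F.b (e.symm z) (coordVec e z v)) e.target := by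
  have hs := (contMDiffOn_symm_of_mem_maximalAtlas he)
  have : ContMDiffOn (𝓡 N) ((𝓡 N).prod 𝓘(ℝ)) ∞
      (fun z ↦ TotalSpace.mk' ℝ (E := Bundle.Trivial M ℝ) (e.symm z)
        (F.b (e.symm z) (coordVec e z v))) e.target := by
    apply ContMDiffOn.clm_bundle_apply (F₁ := Coord N)
    · exact F.contMDiff_b.comp_contMDiffOn hs
    · exact contMDiffOn_coordVec he v
  rw [← contMDiffOn_iff_contDiffOn]
  intro z hz
  have := this z hz
  simp only [contMDiffWithinAt_totalSpace] at this
  exact this.2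

theorem inner_coordVec (F : FinsleroidFinslerSpace N M) (e : OpenPartialHomeomorph M (Coord N))
    (x u v : Coord N) :
    F.a.inner (e.symm x) (coordVec e x u) (coordVec e x v)
      = ∑ i, ∑ j, F.coordA e x i j * u i * v j := by
  rw [coordVec_eq_sum e x u, coordVec_eq_sum e x v]
  simp only [map_sum, map_smul, _root_.sum_apply, _root_.smul_apply,
    smul_eq_mul, coordA, Matrix.of_apply, Finset.mul_sum]
  rw [Finset.sum_comm]
  exact Finset.sum_congr rfl fun i _ => Finset.sum_congr rfl fun j _ => by ring

theorem b_coordVec (F : FinsleroidFinslerSpace N M) (e : OpenPartialHomeomorph M (Coord N))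
    (x v : Coord N) :
    F.b (e.symm x) (coordVec e x v) = Coord.pairing (F.coordB e) x v := by
  rw [coordVec_eq_sum e x v]
  simp only [map_sum, map_smul, smul_eq_mul, coordB, Coord.pairing]
  exact Finset.sum_congr rfl fun j _ => by ring

/-- Cauchy–Schwarz for the unit vector `w` dual to `b`: expand the squared length of `v - b(v) w`.
-/
theorem b_sq_le (F : FinsleroidFinslerSpace N M) (p : M) (v : TangentSpace (𝓡 N) p) :
    F.b p v ^ 2 ≤ F.a.inner p v v := by
  obtain ⟨w, hw, hw1⟩ := F.unit_b p
  have h : 0 ≤ F.a.inner p (v - F.b p v • w) (v - F.b p v • w) := by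
    rcases eq_or_ne (v - F.b p v • w) 0 with h | h
    · rw [h]; simp
    · exact (F.a.pos p _ h).le
  simp only [map_sub, map_smul, _root_.sub_apply, _root_.smul_apply,
    smul_eq_mul, hw, hw1, F.a.symm p v w] at h
  nlinarith

theorem coordA_symm (F : FinsleroidFinslerSpace N M) (e : OpenPartialHomeomorph M (Coord N))
    (x : Coord N) (i j : Fin N) : F.coordA e x i j = F.coordA e x j i :=
  F.a.symm _ _ _

/-- A null vector of the matrix has zero Riemannian length, so its image under the differential of
`e.symm` vanishes; that differential is injective on the target. -/
theorem isUnit_det_coordA (F : FinsleroidFinslerSpace N M)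
    {e : OpenPartialHomeomorph M (Coord N)} (he : e ∈ IsManifold.maximalAtlas (𝓡 N) ∞ M)
    {x : Coord N} (hx : x ∈ e.target) : IsUnit (F.coordA e x).det := by
  rw [← Matrix.isUnit_iff_isUnit_det, ← Matrix.mulVec_injective_iff_isUnit]
  refine (injective_iff_map_eq_zero (F.coordA e x).mulVecLin).2 fun u hu => ?_
  have h0 : F.a.inner (e.symm x) (coordVec e x (WithLp.toLp 2 u)) (coordVec e x (WithLp.toLp 2 u))
      = 0 := by
    rw [inner_coordVec]
    refine Finset.sum_eq_zero fun i _ => ?_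
    have := congrFun hu i
    simp only [Matrix.mulVecLin_apply, Matrix.mulVec, dotProduct, Pi.zero_apply] at this
    calc _ = u i * ∑ j, F.coordA e x i j * u j := by
          rw [Finset.mul_sum]; exact Finset.sum_congr rfl fun j _ => by simp; ring
      _ = 0 := by rw [this, mul_zero]
  have h1 : coordVec e x (WithLp.toLp 2 u) = 0 := by
    by_contra h
    exact (F.a.pos _ _ h).ne' h0
  have hinj := (mdifferentiable_of_mem_maximalAtlas he).symm.mfderiv_injective (x := x) hx
  have h2 : WithLp.toLp 2 u = (0 : Coord N) :=
    hinj (h1.trans (map_zero (mfderiv (𝓡 N) (𝓡 N) e.symm x)).symm)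
  simpa using h2

/-- In coordinates the unit length condition says `b_i b^i = 1`. -/
theorem sum_coordB_mul_raise (F : FinsleroidFinslerSpace N M)
    {e : OpenPartialHomeomorph M (Coord N)} (he : e ∈ IsManifold.maximalAtlas (𝓡 N) ∞ M)
    {x : Coord N} (hx : x ∈ e.target) :
    ∑ i, F.coordB e x i * Coord.raise (F.coordA e) (F.coordB e) x i = 1 := by
  obtain ⟨w, hw, hw1⟩ := F.unit_b (e.symm x)
  -- Surjectivity of the differential gives the dual vector `w` components `c`; then `a c = b`, so
  -- `c` is the raised covector.
  have hsurj := (mdifferentiable_of_mem_maximalAtlas he).symm.mfderiv_surjective (x := x) hx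
  obtain ⟨c, hc'⟩ : ∃ c : Coord N, coordVec e x c = w := hsurj w
  have h1 : (F.coordA e x).mulVec c.ofLp = F.coordB e x := by
    ext i
    have := hw (coordVec e x (EuclideanSpace.single i 1))
    rw [← hc', F.a.symm, inner_coordVec] at this
    simpa [Matrix.mulVec, dotProduct, Pi.single_apply, Finset.sum_ite_eq, coordB] using this
  have h2 : Coord.raise (F.coordA e) (F.coordB e) x = c.ofLp := by
    have : Coord.raise (F.coordA e) (F.coordB e) x = (F.coordA e x)⁻¹.mulVec (F.coordB e x) := rfl
    rw [this, ← h1, Matrix.mulVec_mulVec, Matrix.nonsing_inv_mul _ (F.isUnit_det_coordA he hx),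
      Matrix.one_mulVec]
  rw [← hc', b_coordVec] at hw1
  rw [h2]
  exact hw1

end FinsleroidFinslerSpace

/-! ## The Finsleroid energy as a function of `b` and `q` -/

namespace Finsleroid

open Filter Topology

/-- The constant `h`. -/
noncomputable def modulus (g : ℝ) : ℝ := √(1 - 1 / 4 * g ^ 2)

/-- The angle `Φ` as a function of `b = β` and `q = κ`. -/
noncomputable def phase (g β κ : ℝ) : ℝ :=
  if 0 < β then
    Real.pi / 2 + Real.arctan (g / modulus g / 2)
      - Real.arctan ((κ + g / 2 * β) / (modulus g * β))
  else if β < 0 then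
    -(Real.pi / 2) + Real.arctan (g / modulus g / 2)
      - Real.arctan ((κ + g / 2 * β) / (modulus g * β))
  else Real.arctan (g / modulus g / 2)

/-- The quadratic form `B`. -/
def quad (g β κ : ℝ) : ℝ := β ^ 2 + g * κ * β + κ ^ 2

/-- The factor `e^{G Φ} = K² / B`. -/
noncomputable def weight (g β κ : ℝ) : ℝ :=
  Real.exp (g / modulus g * phase g β κ)

theorem weight_pos (g β κ : ℝ) : 0 < weight g β κ := Real.exp_pos _

theorem one_sub_sq_pos {g : ℝ} (hg : g ∈ Set.Ioo (-2 : ℝ) 2) : 0 < 1 - 1 / 4 * g ^ 2 := by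
  nlinarith [hg.1, hg.2]

theorem modulus_pos {g : ℝ} (hg : g ∈ Set.Ioo (-2 : ℝ) 2) : 0 < modulus g :=
  Real.sqrt_pos.2 (one_sub_sq_pos hg)

theorem quad_nonneg {g : ℝ} (hg : g ∈ Set.Ioo (-2 : ℝ) 2) (β κ : ℝ) : 0 ≤ quad g β κ := by
  have h : quad g β κ = (κ + g / 2 * β) ^ 2 + (1 - 1 / 4 * g ^ 2) * β ^ 2 := by
    unfold quad; ring
  rw [h]
  have := one_sub_sq_pos hg
  positivity

/-- The square is completed in `β`, not in `κ` as for `quad_nonneg`, so that `κ > 0` alone gives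
strict positivity. -/
theorem quad_pos {g : ℝ} (hg : g ∈ Set.Ioo (-2 : ℝ) 2) (β : ℝ) {κ : ℝ} (hκ : 0 < κ) :
    0 < quad g β κ := by
  have h : quad g β κ = (β + g / 2 * κ) ^ 2 + (1 - 1 / 4 * g ^ 2) * κ ^ 2 := by
    unfold quad; ring
  rw [h]
  have := one_sub_sq_pos hg
  positivity

/-- Where `L > 0` there is a single formula for `Φ`. -/
theorem phase_eq_arctan {g : ℝ} (hg : g ∈ Set.Ioo (-2 : ℝ) 2) {β κ : ℝ}
    (hL : 0 < κ + g / 2 * β) :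
    phase g β κ = Real.arctan (g / modulus g / 2)
      + Real.arctan (modulus g * β / (κ + g / 2 * β)) := by
  have hh : 0 < modulus g := modulus_pos hg
  unfold phase
  split_ifs with h1 h2
  · rw [← inv_div (κ + g / 2 * β), Real.arctan_inv_of_pos (by positivity)]
    ring
  · rw [← inv_div (κ + g / 2 * β), Real.arctan_inv_of_neg
      (div_neg_of_pos_of_neg hL (mul_neg_of_pos_of_neg hh h2))]
    ring
  · rw [le_antisymm (not_lt.1 h1) (not_lt.1 h2)]
    simp

variable {E : Type*} [NormedAddCommGroup E] [NormedSpace ℝ E]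

/-- This is the differential of a polar angle. Exchanging `u` and `v` only changes its sign, so the
formulas for `Φ` through `L/(hb)` and through `hb/L` have the same derivative. -/
theorem _root_.HasFDerivAt.arctan_div {u v : E → ℝ} {u' v' : E →L[ℝ] ℝ} {t : E}
    (hu : HasFDerivAt u u' t) (hv : HasFDerivAt v v' t) (h0 : v t ≠ 0) :
    HasFDerivAt (fun s => Real.arctan (u s / v s))
      ((1 / (u t ^ 2 + v t ^ 2)) • (v t • u' - u t • v')) t := by
  have h1 := (hu.mul ((hasDerivAt_inv h0).comp_hasFDerivAt t hv)).arctan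
  have h2 : 0 < u t ^ 2 + v t ^ 2 := by positivity
  have h3 : 0 < v t ^ 2 + u t ^ 2 := by positivity
  refine HasFDerivAt.congr_fderiv (h1)
      (ContinuousLinearMap.ext fun s => ?_)
  simp
  field_simp
  ring

/-! ### Differential and smoothness of the phase, including across `b = 0` -/

section phase

variable {g : ℝ} {β κ : E → ℝ} {β' κ' : E →L[ℝ] ℝ} {t : E}

/-- `Φ` is, up to a local constant, the polar angle of `(L, h b)`, and `L² + (h b)² = B`. For `b ≠
0` one branch of the definition holds locally; at `b = 0` one has `L = q > 0`, and `phase_eq_arctan`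
covers both signs of `b` at once. -/
theorem hasFDerivAt_phase (hg : g ∈ Set.Ioo (-2 : ℝ) 2) (hβ : HasFDerivAt β β' t)
    (hκ : HasFDerivAt κ κ' t) (h0 : 0 < κ t) :
    HasFDerivAt (fun s => phase g (β s) (κ s))
      ((modulus g / quad g (β t) (κ t)) • (κ t • β' - β t • κ')) t := by
  have hh : 0 < modulus g := modulus_pos hg
  have hsq : modulus g ^ 2 = 1 - 1 / 4 * g ^ 2 := Real.sq_sqrt (one_sub_sq_pos hg).le
  have hL := hκ.add (hβ.const_mul (g / 2))
  have hM := hβ.const_mul (modulus g)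
  have hB := quad_pos hg (β t) h0
  have hBe : (κ t + g / 2 * β t) ^ 2 + (modulus g * β t) ^ 2 = quad g (β t) (κ t) := by
    rw [mul_pow, hsq]; unfold quad; ring
  have hBe' : (modulus g * β t) ^ 2 + (κ t + g / 2 * β t) ^ 2 = quad g (β t) (κ t) := by
    rw [← hBe, add_comm]
  rcases lt_trichotomy (β t) 0 with hb | hb | hb
  · have h1 := ((hL.arctan_div hM (by simp [hh.ne', hb.ne])).const_sub
      (-(Real.pi / 2) + Real.arctan (g / modulus g / 2)))
    have h2 := h1.congr_of_eventuallyEq (f₁ := fun s => phase g (β s) (κ s)) (by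
      filter_upwards [hβ.continuousAt.eventually_lt_const hb] with s hs
      simp [phase, hs, not_lt.2 hs.le])
    refine HasFDerivAt.congr_fderiv (h2)
      (ContinuousLinearMap.ext fun s => ?_)
    simp [hBe]
    field_simp
    ring
  · have hL0 : 0 < κ t + g / 2 * β t := by simpa [hb] using h0
    have h1 := ((hM.arctan_div hL hL0.ne').const_add
      (Real.arctan (g / modulus g / 2)))
    have h2 := h1.congr_of_eventuallyEq (f₁ := fun s => phase g (β s) (κ s)) (by
      filter_upwards [hL.continuousAt.eventually_const_lt hL0] with s hs
      exact phase_eq_arctan hg hs)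
    refine HasFDerivAt.congr_fderiv (h2)
      (ContinuousLinearMap.ext fun s => ?_)
    simp [hBe']
    field_simp
    ring
  · have h1 := ((hL.arctan_div hM (by simp [hh.ne', hb.ne'])).const_sub
      ((Real.pi / 2) + Real.arctan (g / modulus g / 2)))
    have h2 := h1.congr_of_eventuallyEq (f₁ := fun s => phase g (β s) (κ s)) (by
      filter_upwards [hβ.continuousAt.eventually_const_lt hb] with s hs
      simp [phase, hs])
    refine HasFDerivAt.congr_fderiv (h2)
      (ContinuousLinearMap.ext fun s => ?_)
    simp [hBe]
    field_simp
    ring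

theorem contDiffAt_phase {n : ℕ∞} (hg : g ∈ Set.Ioo (-2 : ℝ) 2) (hβ : ContDiffAt ℝ n β t)
    (hκ : ContDiffAt ℝ n κ t) (h0 : 0 < κ t) :
    ContDiffAt ℝ n (fun s => phase g (β s) (κ s)) t := by
  have hh : 0 < modulus g := modulus_pos hg
  have hL := hκ.add (contDiffAt_const (c := g / 2) |>.mul hβ)
  have hM := (contDiffAt_const (c := modulus g)).mul hβ
  rcases lt_trichotomy (β t) 0 with hb | hb | hb
  · refine ((contDiffAt_const (c := -(Real.pi / 2) + Real.arctan (g / modulus g / 2))).sub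
      (hL.div hM (by simp [hh.ne', hb.ne])).arctan).congr_of_eventuallyEq ?_
    filter_upwards [hβ.continuousAt.eventually_lt_const hb] with s hs
    simp [phase, hs, not_lt.2 hs.le]
  · have hL0 : 0 < κ t + g / 2 * β t := by simpa [hb] using h0
    refine ((contDiffAt_const (c := Real.arctan (g / modulus g / 2))).add
      (hM.div hL hL0.ne').arctan).congr_of_eventuallyEq ?_
    filter_upwards [hL.continuousAt.eventually_const_lt hL0] with s hs
    exact phase_eq_arctan hg hs
  · refine ((contDiffAt_const (c := (Real.pi / 2) + Real.arctan (g / modulus g / 2))).sub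
      (hL.div hM (by simp [hh.ne', hb.ne'])).arctan).congr_of_eventuallyEq ?_
    filter_upwards [hβ.continuousAt.eventually_const_lt hb] with s hs
    simp [phase, hs]

/-- `G h = g`, so the constant `h` disappears from here on. -/
theorem hasFDerivAt_weight (hg : g ∈ Set.Ioo (-2 : ℝ) 2) (hβ : HasFDerivAt β β' t)
    (hκ : HasFDerivAt κ κ' t) (h0 : 0 < κ t) :
    HasFDerivAt (fun s => weight g (β s) (κ s))
      ((weight g (β t) (κ t) * g / quad g (β t) (κ t)) • (κ t • β' - β t • κ')) t := by
  have hh : 0 < modulus g := modulus_pos hg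
  have hB := quad_pos hg (β t) h0
  refine HasFDerivAt.congr_fderiv
    ((hasFDerivAt_phase hg hβ hκ h0).const_mul (g / modulus g)).exp
      (ContinuousLinearMap.ext fun s => ?_)
  simp [weight]
  field_simp

end phase

/-! ### Along a curve of `(S², b)` -/

section energy

variable {g : ℝ} {σ β α γ : E → ℝ} {σ' β' α' γ' : E →L[ℝ] ℝ} {t : E}

theorem hasFDerivAt_sqrt_sub_sq (hσ : HasFDerivAt σ σ' t) (hβ : HasFDerivAt β β' t)
    (h0 : 0 < σ t - β t ^ 2) :
    HasFDerivAt (fun s => √(σ s - β s ^ 2))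
      ((1 / √(σ t - β t ^ 2)) • ((1 / 2 : ℝ) • σ' - β t • β')) t := by
  have := (hσ.sub (hβ.pow 2)).sqrt (by exact h0.ne')
  refine HasFDerivAt.congr_fderiv (this)
      (ContinuousLinearMap.ext fun s => ?_)
  have := Real.sqrt_pos.2 h0
  simp
  field_simp

/-- With `q² = S² - b²`, `d K² = e^{GΦ} (d S² + 2 g q d b)`. -/
theorem hasFDerivAt_energy (hg : g ∈ Set.Ioo (-2 : ℝ) 2) (hσ : HasFDerivAt σ σ' t)
    (hβ : HasFDerivAt β β' t) (h0 : 0 < σ t - β t ^ 2) :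
    HasFDerivAt (fun s => quad g (β s) √(σ s - β s ^ 2) * weight g (β s) √(σ s - β s ^ 2))
      (weight g (β t) √(σ t - β t ^ 2) • (σ' + (2 * g * √(σ t - β t ^ 2)) • β')) t := by
  have hκ := hasFDerivAt_sqrt_sub_sq hσ hβ h0
  have hq := Real.sqrt_pos.2 h0
  have hB := quad_pos hg (β t) hq
  have h1 : HasFDerivAt (fun s => quad g (β s) √(σ s - β s ^ 2)) _ t :=
    ((hβ.pow 2).add ((hκ.const_mul g).mul hβ)).add (hκ.pow 2)
  refine HasFDerivAt.congr_fderiv (h1.mul (hasFDerivAt_weight hg hβ hκ hq))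
      (ContinuousLinearMap.ext fun s => ?_)
  simp
  field_simp
  ring

/-- The derivative of `e^{GΦ} (α + g q γ)`. -/
theorem hasFDerivAt_momentum (hg : g ∈ Set.Ioo (-2 : ℝ) 2) (hσ : HasFDerivAt σ σ' t)
    (hβ : HasFDerivAt β β' t) (hα : HasFDerivAt α α' t) (hγ : HasFDerivAt γ γ' t)
    (h0 : 0 < σ t - β t ^ 2) :
    HasFDerivAt (fun s => weight g (β s) √(σ s - β s ^ 2) * (α s + g * √(σ s - β s ^ 2) * γ s))
      (weight g (β t) √(σ t - β t ^ 2) •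
        ((g / quad g (β t) √(σ t - β t ^ 2) * (α t + g * √(σ t - β t ^ 2) * γ t)) •
            (√(σ t - β t ^ 2) • β' - (β t / √(σ t - β t ^ 2)) • ((1 / 2 : ℝ) • σ' - β t • β'))
          + (α' + (g * √(σ t - β t ^ 2)) • γ'
            + (g * γ t / √(σ t - β t ^ 2)) • ((1 / 2 : ℝ) • σ' - β t • β')))) t := by
  have hκ := hasFDerivAt_sqrt_sub_sq hσ hβ h0
  have hq := Real.sqrt_pos.2 h0
  have hB := quad_pos hg (β t) hq
  refine HasFDerivAt.congr_fderiv
    ((hasFDerivAt_weight hg hβ hκ hq).mul (hα.add ((hκ.const_mul g).mul hγ)))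
      (ContinuousLinearMap.ext fun s => ?_)
  simp
  field_simp
  ring

end energy

end Finsleroid

namespace Coord

open Finsleroid Filter Topology

variable {N : ℕ}

/-! ### Index gymnastics for the Riemannian metric -/

/-- The Riemannian length `S² = a_{ij} y^i y^j`. -/
def normSq (a : Coord N → Matrix (Fin N) (Fin N) ℝ) (x y : Coord N) : ℝ :=
  ∑ i, ∑ j, a x i j * y i * y j

/-- The covariant components `a_{ni} y^i`. -/
def lower (a : Coord N → Matrix (Fin N) (Fin N) ℝ) (x y : Coord N) (n : Fin N) : ℝ :=
  ∑ i, a x n i * y i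

section algebra

variable {a : Coord N → Matrix (Fin N) (Fin N) ℝ} {b : Coord N → Fin N → ℝ} {x y : Coord N}

theorem sum_mul_inv_mul (ha : IsUnit (a x).det) (w : Fin N → ℝ) (n : Fin N) :
    ∑ i, a x n i * ∑ k, (a x)⁻¹ i k * w k = w n := by
  have : (a x).mulVec ((a x)⁻¹.mulVec w) = w := by
    rw [Matrix.mulVec_mulVec, Matrix.mul_nonsing_inv _ ha, Matrix.one_mulVec]
  exact congrFun this n

theorem inv_symm (hs : ∀ i j, a x i j = a x j i) (i j : Fin N) :
    (a x)⁻¹ i j = (a x)⁻¹ j i := by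
  have h : (a x).transpose = a x := Matrix.ext fun i j => hs j i
  have h2 := Matrix.transpose_nonsing_inv (a x)
  rw [h] at h2
  exact (congrFun (congrFun h2 j) i)

theorem sum_mul_inv_mul_eq_raise (hs : ∀ i j, a x i j = a x j i) (w : Fin N → ℝ) :
    ∑ i, b x i * ∑ k, (a x)⁻¹ i k * w k = ∑ k, raise a b x k * w k := by
  simp only [raise, Finset.mul_sum, Finset.sum_mul]
  rw [Finset.sum_comm]
  refine Finset.sum_congr rfl fun k _ => Finset.sum_congr rfl fun i _ => ?_
  rw [inv_symm hs i k]
  ring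

theorem sum_mul_raise (ha : IsUnit (a x).det) (n : Fin N) :
    ∑ i, a x n i * raise a b x i = b x n :=
  sum_mul_inv_mul ha (b x) n

theorem sum_lower_mul (u : Fin N → ℝ) (hs : ∀ i j, a x i j = a x j i) :
    ∑ n, lower a x y n * u n = ∑ n, y n * ∑ i, a x n i * u i := by
  simp only [lower, Finset.mul_sum, Finset.sum_mul]
  rw [Finset.sum_comm]
  refine Finset.sum_congr rfl fun k _ => Finset.sum_congr rfl fun i _ => ?_
  rw [hs i k]
  ring

theorem sum_lower_mul_self (hs : ∀ i j, a x i j = a x j i) :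
    ∑ n, lower a x y n * y n = normSq a x y := by
  rw [sum_lower_mul _ hs]
  simp only [normSq, Finset.mul_sum]
  exact Finset.sum_congr rfl fun k _ => Finset.sum_congr rfl fun i _ => by ring

theorem sum_lower_mul_raise (ha : IsUnit (a x).det) (hs : ∀ i j, a x i j = a x j i) :
    ∑ n, lower a x y n * raise a b x n = pairing b x y := by
  rw [sum_lower_mul _ hs]
  simp only [sum_mul_raise ha, pairing]
  exact Finset.sum_congr rfl fun k _ => by ring

theorem normSq_raise (ha : IsUnit (a x).det) :
    normSq a x (WithLp.toLp 2 (raise a b x)) = ∑ i, b x i * raise a b x i := by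
  simp only [normSq]
  refine Finset.sum_congr rfl fun k _ => ?_
  rw [← sum_mul_raise (b := b) ha k, Finset.sum_mul]
  exact Finset.sum_congr rfl fun i _ => by ring

theorem sum_metric_mul_vVec (ha : IsUnit (a x).det) (n : Fin N) :
    ∑ i, a x n i * vVec a b x y i = lower a x y n - pairing b x y * b x n := by
  rw [← sum_mul_raise (b := b) ha n]
  simp only [vVec, lower, mul_sub, Finset.sum_sub_distrib, Finset.mul_sum]
  congr 1
  exact Finset.sum_congr rfl fun i _ => by ring

theorem sum_b_mul_vVec (h1 : ∑ i, b x i * raise a b x i = 1) :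
    ∑ i, b x i * vVec a b x y i = 0 := by
  have : ∑ i, b x i * vVec a b x y i
      = pairing b x y - pairing b x y * ∑ i, b x i * raise a b x i := by
    simp only [vVec, pairing, mul_sub, Finset.sum_sub_distrib, Finset.mul_sum]
    congr 1
    exact Finset.sum_congr rfl fun i _ => by ring
  rw [this, h1]
  ring

theorem qScalar_eq (a : Coord N → Matrix (Fin N) (Fin N) ℝ) (b : Coord N → Fin N → ℝ)
    (x y : Coord N) : qScalar a b x y = √(normSq a x y - pairing b x y ^ 2) := by
  unfold qScalar normSq
  congr 1
  rw [sq]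
  simp only [pairing, Finset.sum_mul_sum]
  simp only [← Finset.sum_sub_distrib]
  exact Finset.sum_congr rfl fun k _ => Finset.sum_congr rfl fun i _ => by ring

theorem sub_sq_pos_of_qScalar_pos (hq : 0 < qScalar a b x y) :
    0 < normSq a x y - pairing b x y ^ 2 := by
  rw [qScalar_eq] at hq
  exact Real.sqrt_pos.1 hq

/-! ### Contractions of the connection -/

theorem partialDeriv_symm (hs : ∀ z i j, a z i j = a z j i) (k i j : Fin N) :
    partialDeriv k (fun z => a z i j) x = partialDeriv k (fun z => a z j i) x := by
  simp only [hs _ i j]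

theorem riemannChristoffel_symm (hs : ∀ z i j, a z i j = a z j i) (k i j : Fin N) :
    riemannChristoffel a x k i j = riemannChristoffel a x k j i := by
  unfold riemannChristoffel
  congr 1
  refine Finset.sum_congr rfl fun n _ => ?_
  rw [partialDeriv_symm hs n i j]
  ring

/-- The Christoffel symbols are symmetric in their lower indices and cancel: the curl is the
exterior derivative of `b`. -/
theorem curl_eq (hs : ∀ z i j, a z i j = a z j i) (m n : Fin N) :
    curl a b x m n
      = partialDeriv m (fun z => b z n) x - partialDeriv n (fun z => b z m) x := by
  unfold curl nabla
  simp only [riemannChristoffel_symm hs _ m n]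
  ring

theorem curlVec_eq (i : Fin N) :
    curlVec a b x y i = ∑ k, (a x)⁻¹ i k * ∑ n, curl a b x k n * y n := by
  simp only [curlVec, curlUp, Finset.sum_mul, Finset.mul_sum]
  rw [Finset.sum_comm]
  exact Finset.sum_congr rfl fun k _ => Finset.sum_congr rfl fun i _ => by ring

theorem sum_metric_mul_curlVec (ha : IsUnit (a x).det) (n : Fin N) :
    ∑ i, a x n i * curlVec a b x y i = ∑ k, curl a b x n k * y k := by
  simp only [curlVec_eq]
  exact sum_mul_inv_mul ha (fun k => ∑ n, curl a b x k n * y n) n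

theorem sum_mul_curl_mul : ∑ n, y n * ∑ k, curl a b x n k * y k = 0 := by
  have h : ∑ n, y n * ∑ k, curl a b x n k * y k = - ∑ n, y n * ∑ k, curl a b x n k * y k := by
    conv_lhs => simp only [Finset.mul_sum]
    rw [Finset.sum_comm, ← Finset.sum_neg_distrib]
    refine Finset.sum_congr rfl fun n _ => ?_
    rw [Finset.mul_sum, ← Finset.sum_neg_distrib]
    refine Finset.sum_congr rfl fun k _ => ?_
    unfold curl
    ring
  linarith

/-- `b_i f^i = b^k f_{kn} y^n`, and the half of the curl in which `b^k` meets the differentiated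
covector vanishes by `hb`. This is how unit length enters the spray. -/
theorem sum_b_mul_curlVec (hs : ∀ i j, a x i j = a x j i)
    (hb : ∀ j, ∑ h, raise a b x h * nabla a b x j h = 0) :
    ∑ i, b x i * curlVec a b x y i = ∑ j, ∑ h, y h * raise a b x j * nabla a b x j h := by
  simp only [curlVec_eq]
  rw [sum_mul_inv_mul_eq_raise hs]
  have : ∑ k, raise a b x k * ∑ n, curl a b x k n * y n
      = (∑ j, ∑ h, y h * raise a b x j * nabla a b x j h)
        - ∑ n, y n * ∑ k, raise a b x k * nabla a b x n k := by
    simp only [Finset.mul_sum]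
    rw [Finset.sum_comm (γ := Fin N) (f := fun n k => y n * (raise a b x k * nabla a b x n k))]
    simp only [← Finset.sum_sub_distrib]
    refine Finset.sum_congr rfl fun k _ => Finset.sum_congr rfl fun i _ => ?_
    unfold curl
    ring
  rw [this]
  simp [hb]

/-- Lowering the index of the Riemannian spray. -/
theorem sum_metric_mul_christoffel (ha : IsUnit (a x).det) (n : Fin N) (u v : Fin N → ℝ) :
    ∑ i, a x n i * ∑ k, ∑ m, riemannChristoffel a x i k m * u k * v m
      = 1 / 2 * ∑ k, ∑ m, (partialDeriv m (fun z => a z n k) x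
          + partialDeriv k (fun z => a z n m) x - partialDeriv n (fun z => a z m k) x)
            * u k * v m := by
  rw [← sum_mul_inv_mul ha (fun n => 1 / 2 * ∑ k, ∑ m, (partialDeriv m (fun z => a z n k) x
          + partialDeriv k (fun z => a z n m) x - partialDeriv n (fun z => a z m k) x)
            * u k * v m) n]
  refine Finset.sum_congr rfl fun i _ => ?_
  congr 1
  simp only [riemannChristoffel, Finset.mul_sum, Finset.sum_mul]
  rw [Finset.sum_congr rfl fun k _ => Finset.sum_comm, Finset.sum_comm]
  exact Finset.sum_congr rfl fun k _ => Finset.sum_congr rfl fun i _ =>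
    Finset.sum_congr rfl fun j _ => by ring

/-- The first two terms of the Christoffel bracket become equal when both lower indices are
contracted with the same `y`. -/
theorem sum_metric_mul_spray (hs : ∀ z i j, a z i j = a z j i) (ha : IsUnit (a x).det)
    (n : Fin N) :
    ∑ i, a x n i * ∑ k, ∑ m, riemannChristoffel a x i k m * y k * y m
      = (∑ j, ∑ k, y j * y k * partialDeriv j (fun z => a z n k) x)
        - 1 / 2 * ∑ j, ∑ k, y j * y k * partialDeriv n (fun z => a z j k) x := by
  rw [sum_metric_mul_christoffel ha]
  have h1 : ∑ k, ∑ m, (partialDeriv m (fun z => a z n k) x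
          + partialDeriv k (fun z => a z n m) x - partialDeriv n (fun z => a z m k) x) * y k * y m
      = (∑ k, ∑ m, y m * y k * partialDeriv m (fun z => a z n k) x)
        + (∑ k, ∑ m, y k * y m * partialDeriv k (fun z => a z n m) x)
        - ∑ k, ∑ m, y k * y m * partialDeriv n (fun z => a z k m) x := by
    simp only [← Finset.sum_sub_distrib, ← Finset.sum_add_distrib]
    refine Finset.sum_congr rfl fun k _ => Finset.sum_congr rfl fun i _ => ?_
    rw [partialDeriv_symm hs n i k]
    ring
  rw [h1, Finset.sum_comm (f := fun k m => y m * y k * partialDeriv m (fun z => a z n k) x)]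
  ring

theorem sum_mul_nabla :
    ∑ j, ∑ h, y j * y h * nabla a b x j h
      = (∑ j, ∑ h, y j * y h * partialDeriv j (fun z => b z h) x)
        - ∑ i, b x i * ∑ k, ∑ m, riemannChristoffel a x i k m * y k * y m := by
  have h1 : ∑ i, b x i * ∑ k, ∑ m, riemannChristoffel a x i k m * y k * y m
      = ∑ k, ∑ m, ∑ i, y k * y m * (riemannChristoffel a x i k m * b x i) := by
    simp only [Finset.mul_sum]
    rw [Finset.sum_comm]
    refine Finset.sum_congr rfl fun k _ => ?_
    rw [Finset.sum_comm]
    exact Finset.sum_congr rfl fun k _ => Finset.sum_congr rfl fun i _ => by ring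
  rw [h1]
  simp only [nabla, mul_sub, Finset.mul_sum, Finset.sum_sub_distrib]

end algebra

/-! ### Derivatives of `S²`, `b` and `a_{ni} y^i` -/

section deriv

variable {a : Coord N → Matrix (Fin N) (Fin N) ℝ} {b : Coord N → Fin N → ℝ}

theorem sum_mul_partialDeriv (f : Coord N → ℝ) (x y : Coord N) :
    ∑ j, y j * partialDeriv j f x = fderiv ℝ f x y := by
  have hy : y = ∑ i, y i • EuclideanSpace.single i (1 : ℝ) := by
    ext j
    simp [Pi.single_apply]
  conv_rhs => rw [hy]
  simp [partialDeriv, map_sum]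

theorem hasFDerivAt_pairing_right (x y : Coord N) :
    HasFDerivAt (fun w => pairing b x w)
      (∑ i, b x i • (EuclideanSpace.proj i : Coord N →L[ℝ] ℝ)) y :=
  HasFDerivAt.fun_sum fun i _ => (EuclideanSpace.proj i : Coord N →L[ℝ] ℝ).hasFDerivAt.const_mul _

theorem hasFDerivAt_lower_right (x y : Coord N) (n : Fin N) :
    HasFDerivAt (fun w => lower a x w n)
      (∑ i, a x n i • (EuclideanSpace.proj i : Coord N →L[ℝ] ℝ)) y :=
  HasFDerivAt.fun_sum fun i _ => (EuclideanSpace.proj i : Coord N →L[ℝ] ℝ).hasFDerivAt.const_mul _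

theorem hasFDerivAt_normSq_right (hs : ∀ i j, a x i j = a x j i) (y : Coord N) :
    HasFDerivAt (fun w => normSq a x w)
      ((2 : ℝ) • ∑ i, lower a x y i • (EuclideanSpace.proj i : Coord N →L[ℝ] ℝ)) y := by
  have h : HasFDerivAt (fun w : Coord N => ∑ i, w i * lower a x w i) _ y :=
    HasFDerivAt.fun_sum fun i _ => (EuclideanSpace.proj i : Coord N →L[ℝ] ℝ).hasFDerivAt.mul
      (hasFDerivAt_lower_right x y i)
  have he : (fun w => normSq a x w) = fun w : Coord N => ∑ i, w i * lower a x w i := by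
    funext w
    rw [← sum_lower_mul_self hs]
    exact Finset.sum_congr rfl fun i _ => mul_comm _ _
  rw [he]
  refine h.congr_fderiv
      (ContinuousLinearMap.ext fun s => ?_)
  have := sum_lower_mul (y := y) s hs
  simp [Finset.sum_add_distrib, ← this]
  ring

variable {x : Coord N}

theorem hasFDerivAt_pairing_left (hb : ∀ i, DifferentiableAt ℝ (fun z => b z i) x) (y : Coord N) :
    HasFDerivAt (fun z => pairing b z y) (∑ i, y i • fderiv ℝ (fun z => b z i) x) x :=
  HasFDerivAt.fun_sum fun i _ => (hb i).hasFDerivAt.mul_const _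

theorem hasFDerivAt_lower_left (ha : ∀ i j, DifferentiableAt ℝ (fun z => a z i j) x) (y : Coord N)
    (n : Fin N) :
    HasFDerivAt (fun z => lower a z y n) (∑ i, y i • fderiv ℝ (fun z => a z n i) x) x :=
  HasFDerivAt.fun_sum fun i _ => (ha n i).hasFDerivAt.mul_const _

theorem hasFDerivAt_normSq_left (ha : ∀ i j, DifferentiableAt ℝ (fun z => a z i j) x)
    (y : Coord N) :
    HasFDerivAt (fun z => normSq a z y)
      (∑ i, ∑ j, y j • y i • fderiv ℝ (fun z => a z i j) x) x :=
  HasFDerivAt.fun_sum fun i _ => HasFDerivAt.fun_sum fun j _ =>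
    ((ha i j).hasFDerivAt.mul_const _).mul_const _

/-- Since `b` is a unit form, `b^h ∇_j b_h = 0`: at `x` the nonnegative function
`z ↦ a_{ij}(z) c^i c^j - (b_i(z) c^i)²` with `c = (b^i(x))` attains its minimum. -/
theorem sum_raise_mul_nabla (ha : ∀ i j, DifferentiableAt ℝ (fun z => a z i j) x)
    (hb : ∀ i, DifferentiableAt ℝ (fun z => b z i) x) (hs : ∀ z i j, a z i j = a z j i)
    (hdet : IsUnit (a x).det) (hle : ∀ z y, pairing b z y ^ 2 ≤ normSq a z y)
    (h1 : ∑ i, b x i * raise a b x i = 1) (j : Fin N) :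
    ∑ h, raise a b x h * nabla a b x j h = 0 := by
  -- The vector `c` is frozen at its value at `x`, so no derivative of the inverse matrix occurs.
  set c : Coord N := WithLp.toLp 2 (raise a b x) with hc
  have hp : pairing b x c = 1 := h1
  have hn : normSq a x c = 1 := by rw [hc, normSq_raise hdet, h1]
  have hd := (hasFDerivAt_normSq_left ha c).sub ((hasFDerivAt_pairing_left hb c).pow 2)
  have hmin : IsLocalMin ((fun z => normSq a z c) - fun z => pairing b z c ^ 2) x := by
    refine Filter.Eventually.of_forall fun z => ?_
    simp only [Pi.sub_apply, hn, hp]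
    linarith [hle z c]
  have h0 := hmin.hasFDerivAt_eq_zero hd
  have h2 := congrArg (fun L : Coord N →L[ℝ] ℝ => L (EuclideanSpace.single j 1)) h0
  have h3 : (∑ i, ∑ k, c k * (c i * partialDeriv j (fun z => a z i k) x))
      - 2 * ∑ i, c i * partialDeriv j (fun z => b z i) x = 0 := by
    simpa [hp, partialDeriv] using h2
  -- With `b_k` written as `a_{kn} c^n`, the Christoffel term is a lowered symbol contracted twice
  -- with `c`; two of its three derivatives are exchanged by the symmetry of `c^n c^m` and cancel.
  have h4 : ∑ h, raise a b x h * ∑ k, riemannChristoffel a x k j h * b x k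
      = 1 / 2 * ∑ i, ∑ k, c k * (c i * partialDeriv j (fun z => a z i k) x) := by
    have e1 : ∑ h, raise a b x h * ∑ k, riemannChristoffel a x k j h * b x k
        = ∑ i, b x i * ∑ k, ∑ m, riemannChristoffel a x i k m * (Pi.single j 1 : Fin N → ℝ) k * c m := by
      simp only [Pi.single_apply, mul_ite, mul_one, mul_zero, ite_mul, zero_mul]
      simp only [Finset.mul_sum]
      rw [Finset.sum_comm]
      refine Finset.sum_congr rfl fun i _ => ?_
      rw [Finset.sum_comm]
      refine Finset.sum_congr rfl fun k _ => ?_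
      simp [hc]
      ring
    have e2 : ∀ i, b x i = ∑ n, a x i n * c n := fun i => (sum_mul_raise hdet i).symm
    have e3 : ∀ w : Fin N → ℝ, ∑ i, b x i * w i = ∑ n, c n * ∑ i, a x n i * w i := by
      intro w
      rw [← sum_lower_mul w (hs x)]
      exact Finset.sum_congr rfl fun i _ => by rw [e2 i, lower]
    rw [e1, e3]
    simp only [sum_metric_mul_christoffel hdet]
    have e4 : ∀ n, ∑ k, ∑ m, (partialDeriv m (fun z => a z n k) x
          + partialDeriv k (fun z => a z n m) x - partialDeriv n (fun z => a z m k) x)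
            * (Pi.single j 1 : Fin N → ℝ) k * c m
        = ∑ m, (partialDeriv m (fun z => a z n j) x
          + partialDeriv j (fun z => a z n m) x - partialDeriv n (fun z => a z m j) x) * c m := by
      intro n
      rw [Finset.sum_comm]
      exact Finset.sum_congr rfl fun k _ => by simp [Pi.single_apply]
    simp only [e4]
    have e5 : ∑ n, c n * ∑ m, (partialDeriv m (fun z => a z n j) x
          + partialDeriv j (fun z => a z n m) x - partialDeriv n (fun z => a z m j) x) * c m
        = (∑ n, ∑ m, c n * c m * partialDeriv m (fun z => a z n j) x)
          + (∑ i, ∑ k, c k * (c i * partialDeriv j (fun z => a z i k) x))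
          - ∑ n, ∑ m, c m * c n * partialDeriv n (fun z => a z m j) x := by
      simp only [Finset.mul_sum, ← Finset.sum_sub_distrib, ← Finset.sum_add_distrib]
      exact Finset.sum_congr rfl fun k _ => Finset.sum_congr rfl fun i _ => by ring
    rw [Finset.sum_comm (f := fun n m => c m * c n * partialDeriv n (fun z => a z m j) x)] at e5
    have e6 : ∑ n, c n * (1 / 2 * ∑ m, (partialDeriv m (fun z => a z n j) x
          + partialDeriv j (fun z => a z n m) x - partialDeriv n (fun z => a z m j) x) * c m)
        = 1 / 2 * ∑ n, c n * ∑ m, (partialDeriv m (fun z => a z n j) x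
          + partialDeriv j (fun z => a z n m) x - partialDeriv n (fun z => a z m j) x) * c m := by
      rw [Finset.mul_sum]
      exact Finset.sum_congr rfl fun k _ => by ring
    rw [e6, e5]
    ring
  have h5 : ∑ h, raise a b x h * nabla a b x j h
      = (∑ i, c i * partialDeriv j (fun z => b z i) x)
        - ∑ h, raise a b x h * ∑ k, riemannChristoffel a x k j h * b x k := by
    simp only [nabla, mul_sub, Finset.sum_sub_distrib, hc]
  rw [h5, h4]
  linarith

end deriv

end Coord

namespace Coord

open Finsleroid Filter Topology

variable {N : ℕ}

/-! ### The Finsler metric of the Finsleroid energy -/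

/-- The energy `K² = B e^{GΦ}`. -/
noncomputable def finsleroidEnergy (g : ℝ) (a : Coord N → Matrix (Fin N) (Fin N) ℝ)
    (b : Coord N → Fin N → ℝ) (x y : Coord N) : ℝ :=
  quad g (pairing b x y) √(normSq a x y - pairing b x y ^ 2)
    * weight g (pairing b x y) √(normSq a x y - pairing b x y ^ 2)

/-- The momentum `½ ∂K²/∂y^n = e^{GΦ} (a_{ni} y^i + g q b_n)`. -/
noncomputable def finsleroidMomentum (g : ℝ) (a : Coord N → Matrix (Fin N) (Fin N) ℝ)
    (b : Coord N → Fin N → ℝ) (x y : Coord N) (n : Fin N) : ℝ :=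
  weight g (pairing b x y) √(normSq a x y - pairing b x y ^ 2)
    * (lower a x y n + g * √(normSq a x y - pairing b x y ^ 2) * b x n)

section

variable {g : ℝ} {a : Coord N → Matrix (Fin N) (Fin N) ℝ} {b : Coord N → Fin N → ℝ}
  {K : Coord N → Coord N → ℝ} {x y : Coord N}

theorem partialDeriv_energy (hg : g ∈ Set.Ioo (-2 : ℝ) 2) (hs : ∀ i j, a x i j = a x j i)
    (h0 : 0 < normSq a x y - pairing b x y ^ 2) (n : Fin N) :
    partialDeriv n (fun w => finsleroidEnergy g a b x w) y = 2 * finsleroidMomentum g a b x y n := by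
  have h : HasFDerivAt (fun w => finsleroidEnergy g a b x w) _ y :=
    hasFDerivAt_energy hg (hasFDerivAt_normSq_right hs y) (hasFDerivAt_pairing_right x y) h0
  rw [partialDeriv, h.fderiv, finsleroidMomentum]
  simp
  ring

theorem eventually_pos_right (hs : ∀ i j, a x i j = a x j i)
    (h0 : 0 < normSq a x y - pairing b x y ^ 2) :
    ∀ᶠ w in 𝓝 y, 0 < normSq a x w - pairing b x w ^ 2 :=
  ((hasFDerivAt_normSq_right hs y).continuousAt.sub
    ((hasFDerivAt_pairing_right x y).continuousAt.pow 2)).eventually_const_lt h0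

theorem eventually_pos_left (ha : ∀ i j, DifferentiableAt ℝ (fun z => a z i j) x)
    (hb : ∀ i, DifferentiableAt ℝ (fun z => b z i) x)
    (h0 : 0 < normSq a x y - pairing b x y ^ 2) :
    ∀ᶠ z in 𝓝 x, 0 < normSq a z y - pairing b z y ^ 2 :=
  ((hasFDerivAt_normSq_left ha y).continuousAt.sub
    ((hasFDerivAt_pairing_left hb y).continuousAt.pow 2)).eventually_const_lt h0

/-- The explicit components `g_{ij}`. -/
theorem finslerMetric_eq (hg : g ∈ Set.Ioo (-2 : ℝ) 2) (hs : ∀ i j, a x i j = a x j i)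
    (hK : ∀ z w, K z w ^ 2 = finsleroidEnergy g a b z w)
    (h0 : 0 < normSq a x y - pairing b x y ^ 2) (i j : Fin N) :
    finslerMetric K x y i j
      = weight g (pairing b x y) √(normSq a x y - pairing b x y ^ 2) *
        (g / quad g (pairing b x y) √(normSq a x y - pairing b x y ^ 2)
            * (lower a x y j + g * √(normSq a x y - pairing b x y ^ 2) * b x j)
            * (√(normSq a x y - pairing b x y ^ 2) * b x i
              - pairing b x y / √(normSq a x y - pairing b x y ^ 2)
                * (lower a x y i - pairing b x y * b x i))
          + a x i j
          + g * b x j / √(normSq a x y - pairing b x y ^ 2)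
            * (lower a x y i - pairing b x y * b x i)) := by
  -- The first derivative must be known near `y`, not only at `y`, before differentiating again; `q
  -- > 0` is an open condition.
  have h1 : (fun w => partialDeriv j (fun z => K x z ^ 2) w) =ᶠ[𝓝 y]
      fun w => 2 * finsleroidMomentum g a b x w j := by
    filter_upwards [eventually_pos_right hs h0] with w hw
    rw [← partialDeriv_energy hg hs hw]
    simp only [hK]
  have h : HasFDerivAt (fun w => finsleroidMomentum g a b x w j) _ y :=
    hasFDerivAt_momentum hg (hasFDerivAt_normSq_right hs y) (hasFDerivAt_pairing_right x y)
      (hasFDerivAt_lower_right x y j) (hasFDerivAt_const (b x j) y) h0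
  rw [finslerMetric, Matrix.of_apply, partialDeriv, h1.fderiv_eq, (h.const_mul 2).fderiv]
  simp [hs i j]
  ring

/-- The metric applied to a vector. -/
theorem sum_finslerMetric_mul (hg : g ∈ Set.Ioo (-2 : ℝ) 2) (hs : ∀ i j, a x i j = a x j i)
    (hK : ∀ z w, K z w ^ 2 = finsleroidEnergy g a b z w)
    (h0 : 0 < normSq a x y - pairing b x y ^ 2) (u : Fin N → ℝ) (i : Fin N) :
    ∑ j, finslerMetric K x y i j * u j
      = weight g (pairing b x y) √(normSq a x y - pairing b x y ^ 2) *
        (g / quad g (pairing b x y) √(normSq a x y - pairing b x y ^ 2)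
            * ((∑ j, lower a x y j * u j)
              + g * √(normSq a x y - pairing b x y ^ 2) * ∑ j, b x j * u j)
            * (√(normSq a x y - pairing b x y ^ 2) * b x i
              - pairing b x y / √(normSq a x y - pairing b x y ^ 2)
                * (lower a x y i - pairing b x y * b x i))
          + (∑ j, a x i j * u j)
          + g * (∑ j, b x j * u j) / √(normSq a x y - pairing b x y ^ 2)
            * (lower a x y i - pairing b x y * b x i)) := by
  simp only [finslerMetric_eq hg hs hK h0]
  generalize √(normSq a x y - pairing b x y ^ 2) = q
  simp only [Finset.mul_sum, Finset.sum_div, Finset.sum_mul, mul_add, add_mul,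
    Finset.sum_add_distrib]
  refine congrArg₂ _ (congrArg₂ _ (congrArg₂ _ ?_ ?_) ?_) ?_ <;>
    exact Finset.sum_congr rfl fun j _ => by ring

theorem quad_sqrt (h0 : 0 < normSq a x y - pairing b x y ^ 2) :
    normSq a x y + g * √(normSq a x y - pairing b x y ^ 2) * pairing b x y
      = quad g (pairing b x y) √(normSq a x y - pairing b x y ^ 2) := by
  rw [quad, Real.sq_sqrt h0.le]
  ring

/-- Euler's relation for the degree-one momentum, read off from the components: `y_j y^j + g q b =
B` cancels the denominator `B`. -/
theorem sum_finslerMetric_mul_self (hg : g ∈ Set.Ioo (-2 : ℝ) 2) (hs : ∀ i j, a x i j = a x j i)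
    (hK : ∀ z w, K z w ^ 2 = finsleroidEnergy g a b z w)
    (h0 : 0 < normSq a x y - pairing b x y ^ 2) (i : Fin N) :
    ∑ j, finslerMetric K x y i j * y j = finsleroidMomentum g a b x y i := by
  have hq := Real.sqrt_pos.2 h0
  have hB := quad_pos hg (pairing b x y) hq
  have hp : ∑ j, b x j * y j = pairing b x y := rfl
  have hl : ∑ j, a x i j * y j = lower a x y i := rfl
  rw [sum_finslerMetric_mul hg hs hK h0, sum_lower_mul_self hs, hp, hl, quad_sqrt h0,
    finsleroidMomentum]
  field_simp
  ring

theorem sum_mul_momentum (hs : ∀ i j, a x i j = a x j i)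
    (h0 : 0 < normSq a x y - pairing b x y ^ 2) :
    ∑ n, y n * finsleroidMomentum g a b x y n = finsleroidEnergy g a b x y := by
  have h : ∑ n, y n * finsleroidMomentum g a b x y n
      = weight g (pairing b x y) √(normSq a x y - pairing b x y ^ 2) *
        ((∑ n, lower a x y n * y n)
          + g * √(normSq a x y - pairing b x y ^ 2) * ∑ n, b x n * y n) := by
    simp only [finsleroidMomentum, Finset.mul_sum, ← Finset.sum_add_distrib]
    exact Finset.sum_congr rfl fun j _ => by ring
  have hp : ∑ j, b x j * y j = pairing b x y := rfl
  rw [h, sum_lower_mul_self hs, hp, quad_sqrt h0, finsleroidEnergy]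
  ring

/-- The Finsler metric tensor is nondegenerate. -/
theorem isUnit_det_finslerMetric (hg : g ∈ Set.Ioo (-2 : ℝ) 2) (hs : ∀ i j, a x i j = a x j i)
    (hK : ∀ z w, K z w ^ 2 = finsleroidEnergy g a b z w) (hdet : IsUnit (a x).det)
    (h1 : ∑ i, b x i * raise a b x i = 1) (h0 : 0 < normSq a x y - pairing b x y ^ 2) :
    IsUnit (finslerMetric K x y).det := by
  rw [← Matrix.isUnit_iff_isUnit_det, ← Matrix.mulVec_injective_iff_isUnit]
  refine (injective_iff_map_eq_zero (finslerMetric K x y).mulVecLin).2 fun u hu => ?_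
  have hq := Real.sqrt_pos.2 h0
  have hqq := Real.sq_sqrt h0.le
  have hB := quad_pos hg (pairing b x y) hq
  have hw := weight_pos g (pairing b x y) √(normSq a x y - pairing b x y ^ 2)
  set q := √(normSq a x y - pairing b x y ^ 2)
  set α := ∑ j, lower a x y j * u j with hα
  set β := ∑ j, b x j * u j with hβ
  have h2 : ∀ i, g / quad g (pairing b x y) q * (α + g * q * β)
            * (q * b x i - pairing b x y / q * (lower a x y i - pairing b x y * b x i))
          + (∑ j, a x i j * u j)
          + g * β / q * (lower a x y i - pairing b x y * b x i) = 0 := fun i => by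
    have h3 : ∑ j, finslerMetric K x y i j * u j = 0 := congrFun hu i
    rw [sum_finslerMetric_mul hg hs hK h0] at h3
    exact (mul_eq_zero.1 h3).resolve_left hw.ne'
  have hsum : ∀ c d e : ℝ, ∀ f w : Fin N → ℝ,
      ∑ i, f i * (c * (q * b x i - d * (lower a x y i - pairing b x y * b x i))
          + w i + e * (lower a x y i - pairing b x y * b x i))
        = c * (q * (∑ i, b x i * f i)
            - d * ((∑ i, lower a x y i * f i) - pairing b x y * ∑ i, b x i * f i))
          + (∑ i, f i * w i)
          + e * ((∑ i, lower a x y i * f i) - pairing b x y * ∑ i, b x i * f i) := by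
    intro c d e f w
    simp only [Finset.mul_sum, ← Finset.sum_sub_distrib, ← Finset.sum_add_distrib]
    exact Finset.sum_congr rfl fun j _ => by ring
  have hp : ∑ j, b x j * y j = pairing b x y := rfl
  have hy := hsum (g / quad g (pairing b x y) q * (α + g * q * β)) (pairing b x y / q) (g * β / q) y
    (fun i => ∑ j, a x i j * u j)
  simp only [h2, mul_zero, Finset.sum_const_zero, sum_lower_mul_self hs, hp,
    ← sum_lower_mul u hs, ← hα] at hy
  have e1 : normSq a x y - pairing b x y * pairing b x y = q ^ 2 := by rw [hqq]; ring
  rw [e1] at hy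
  have e3 : pairing b x y / q * q ^ 2 = q * pairing b x y := by field_simp
  have e4 : g * β / q * q ^ 2 = g * q * β := by field_simp
  have h4 : α + g * q * β = 0 := by
    rw [e3, e4] at hy
    linear_combination -hy
  have hr := hsum (g / quad g (pairing b x y) q * (α + g * q * β)) (pairing b x y / q) (g * β / q)
    (raise a b x) (fun i => ∑ j, a x i j * u j)
  have e2 : ∑ i, raise a b x i * ∑ j, a x i j * u j = β := by
    have : ∀ i, lower a x (WithLp.toLp 2 (raise a b x)) i = b x i := fun i => sum_mul_raise hdet i
    rw [hβ, ← sum_lower_mul (y := WithLp.toLp 2 (raise a b x)) u hs]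
    simp only [this]
  simp only [h2, mul_zero, Finset.sum_const_zero, sum_lower_mul_raise hdet hs, h1, e2] at hr
  have h5 : β = 0 := by
    rw [h4] at hr
    linear_combination -hr
  have h6 : (a x).mulVec u = 0 := by
    ext i
    have := h2 i
    rw [h4, h5] at this
    simpa [Matrix.mulVec, dotProduct] using this
  have h7 := congrArg ((a x)⁻¹.mulVec) h6
  rwa [Matrix.mulVec_mulVec, Matrix.nonsing_inv_mul _ hdet, Matrix.one_mulVec,
    Matrix.mulVec_zero] at h7

/-! ### The spray -/

/-- The `y`-derivatives that define the metric tensor do not show how it depends on `x`; the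
explicit components, valid for all base points near `x`, do. -/
theorem differentiableAt_finslerMetric (hg : g ∈ Set.Ioo (-2 : ℝ) 2)
    (hs : ∀ z i j, a z i j = a z j i) (hK : ∀ z w, K z w ^ 2 = finsleroidEnergy g a b z w)
    (ha : ∀ i j, DifferentiableAt ℝ (fun z => a z i j) x)
    (hb : ∀ i, DifferentiableAt ℝ (fun z => b z i) x)
    (h0 : 0 < normSq a x y - pairing b x y ^ 2) (i j : Fin N) :
    DifferentiableAt ℝ (fun z => finslerMetric K z y i j) x := by
  have hσ := hasFDerivAt_normSq_left ha y
  have hβ := hasFDerivAt_pairing_left hb y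
  have hκ := hasFDerivAt_sqrt_sub_sq hσ hβ h0
  have hq := Real.sqrt_pos.2 h0
  have hB := quad_pos hg (pairing b x y) hq
  have hw := (hasFDerivAt_weight hg hβ hκ hq).differentiableAt
  have hl := fun n => (hasFDerivAt_lower_left ha y n).differentiableAt
  have hβ' := hβ.differentiableAt
  have hκ' := hκ.differentiableAt
  refine DifferentiableAt.congr_of_eventuallyEq ?_
    ((eventually_pos_left ha hb h0).mono fun z hz => finslerMetric_eq hg (hs z) hK hz i j)
  have hli := hl i
  have hlj := hl j
  have hbi := hb i
  have hbj := hb j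
  have hij := ha i j
  have hQ : DifferentiableAt ℝ (fun z => quad g (pairing b z y)
      √(normSq a z y - pairing b z y ^ 2)) x := by
    unfold quad
    fun_prop
  have hB' := hB.ne'
  have hq' := hq.ne'
  fun_prop (disch := assumption)

/-- `γ_{inj} y^i y^j = y^j ∂_j p_n - ½ ∂_n K²`, with the momentum `p_n`. -/
theorem sum_finslerChristoffelLow (hg : g ∈ Set.Ioo (-2 : ℝ) 2)
    (hs : ∀ z i j, a z i j = a z j i) (hK : ∀ z w, K z w ^ 2 = finsleroidEnergy g a b z w)
    (ha : ∀ i j, DifferentiableAt ℝ (fun z => a z i j) x)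
    (hb : ∀ i, DifferentiableAt ℝ (fun z => b z i) x)
    (h0 : 0 < normSq a x y - pairing b x y ^ 2) (n : Fin N) :
    ∑ i, ∑ j, finslerChristoffelLow K x y i n j * y i * y j
      = fderiv ℝ (fun z => finsleroidMomentum g a b z y n) x y
        - 1 / 2 * partialDeriv n (fun z => finsleroidEnergy g a b z y) x := by
  have hd := differentiableAt_finslerMetric hg hs hK ha hb h0
  have hev := eventually_pos_left ha hb h0
  -- The `x`-derivatives are taken at fixed `y`, so the factors `y^i` pass inside and `g_{mi} y^i =
  -- p_m` can be differentiated.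
  have hm : ∀ j m, ∑ i, y i * partialDeriv j (fun z => finslerMetric K z y m i) x
      = partialDeriv j (fun z => finsleroidMomentum g a b z y m) x := by
    intro j m
    have h1 : (fun z => finsleroidMomentum g a b z y m) =ᶠ[𝓝 x]
        fun z => ∑ i, finslerMetric K z y m i * y i :=
      hev.mono fun z hz => (sum_finslerMetric_mul_self hg (hs z) hK hz m).symm
    rw [partialDeriv, h1.fderiv_eq,
      (HasFDerivAt.fun_sum fun i _ => (hd m i).hasFDerivAt.mul_const (y i)).fderiv]
    simp [partialDeriv]
  have hmd : ∀ m, DifferentiableAt ℝ (fun z => finsleroidMomentum g a b z y m) x := fun m =>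
    (hasFDerivAt_momentum hg (hasFDerivAt_normSq_left ha y) (hasFDerivAt_pairing_left hb y)
      (hasFDerivAt_lower_left ha y m) (hb m).hasFDerivAt h0).differentiableAt
  have he : ∑ j, y j * partialDeriv n (fun z => finsleroidMomentum g a b z y j) x
      = partialDeriv n (fun z => finsleroidEnergy g a b z y) x := by
    have h1 : (fun z => finsleroidEnergy g a b z y) =ᶠ[𝓝 x]
        fun z => ∑ j, y j * finsleroidMomentum g a b z y j :=
      hev.mono fun z hz => (sum_mul_momentum (hs z) hz).symm
    rw [partialDeriv, h1.fderiv_eq,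
      (HasFDerivAt.fun_sum fun j _ => (hmd j).hasFDerivAt.const_mul (y j)).fderiv]
    simp [partialDeriv]
  have hsplit : ∑ i, ∑ j, finslerChristoffelLow K x y i n j * y i * y j
      = 1 / 2 * ((∑ i, ∑ j, y j * (y i * partialDeriv j (fun z => finslerMetric K z y n i) x))
        + (∑ i, y i * ∑ j, y j * partialDeriv i (fun z => finslerMetric K z y n j) x)
        - ∑ i, ∑ j, y j * (y i * partialDeriv n (fun z => finslerMetric K z y j i) x)) := by
    simp only [finslerChristoffelLow, ← Finset.sum_add_distrib, ← Finset.sum_sub_distrib,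
      Finset.mul_sum]
    exact Finset.sum_congr rfl fun i _ => Finset.sum_congr rfl fun j _ => by ring
  rw [hsplit, Finset.sum_comm (f := fun i j => y j * (y i *
      partialDeriv j (fun z => finslerMetric K z y n i) x)),
    Finset.sum_comm (f := fun i j => y j * (y i *
      partialDeriv n (fun z => finslerMetric K z y j i) x))]
  simp only [← Finset.mul_sum, hm, he, sum_mul_partialDeriv]
  ring

end

end Coord

namespace Coord

open Finsleroid Filter Topology

variable {N : ℕ}

section

variable {g : ℝ} {a : Coord N → Matrix (Fin N) (Fin N) ℝ} {b : Coord N → Fin N → ℝ}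
  {K : Coord N → Coord N → ℝ} {x y : Coord N}

/-! ### Contractions of the spray coefficients -/

theorem sum_mul_sprayForm (c₁ c₂ c₃ : ℝ) (f : Fin N → ℝ) :
    ∑ i, f i * sprayForm a b c₁ c₂ c₃ x y i
      = (c₁ * (1 / qScalar a b x y) * (∑ j, ∑ h, y j * y h * nabla a b x j h)
          + c₂ * (∑ j, ∑ h, y h * raise a b x j * nabla a b x j h)) * (∑ i, f i * vVec a b x y i)
        + c₃ * qScalar a b x y * (∑ i, f i * curlVec a b x y i)
        + ∑ i, f i * ∑ k, ∑ m, riemannChristoffel a x i k m * y k * y m := by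
  simp only [sprayForm]
  generalize (∑ j, ∑ h, y j * y h * nabla a b x j h) = T
  generalize (∑ j, ∑ h, y h * raise a b x j * nabla a b x j h) = s
  have : ∀ w : Fin N → ℝ, ∑ i, f i * (c₁ * (1 / qScalar a b x y) * T * vVec a b x y i
      + c₂ * s * vVec a b x y i + c₃ * qScalar a b x y * curlVec a b x y i + w i)
      = (c₁ * (1 / qScalar a b x y) * T + c₂ * s) * (∑ i, f i * vVec a b x y i)
        + c₃ * qScalar a b x y * (∑ i, f i * curlVec a b x y i) + ∑ i, f i * w i := by
    intro w
    simp only [Finset.mul_sum, ← Finset.sum_add_distrib]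
    exact Finset.sum_congr rfl fun j _ => by ring
  exact this _

/-- `y_i v^i = q²`, and `y_i f^i = 0` because the curl is skew, so `c₃` drops out. -/
theorem sum_lower_mul_sprayForm (hs : ∀ z i j, a z i j = a z j i) (hdet : IsUnit (a x).det)
    (h0 : 0 < normSq a x y - pairing b x y ^ 2) (c₁ c₂ c₃ : ℝ) :
    ∑ i, lower a x y i * sprayForm a b c₁ c₂ c₃ x y i
      = (c₁ * (1 / qScalar a b x y) * (∑ j, ∑ h, y j * y h * nabla a b x j h)
          + c₂ * (∑ j, ∑ h, y h * raise a b x j * nabla a b x j h)) * qScalar a b x y ^ 2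
        + 1 / 2 * ∑ n, y n * ∑ j, ∑ k, y j * y k * partialDeriv n (fun z => a z j k) x := by
  have h1 : ∑ i, lower a x y i * vVec a b x y i = qScalar a b x y ^ 2 := by
    rw [sum_lower_mul _ (hs x), qScalar_eq, Real.sq_sqrt h0.le]
    simp only [sum_metric_mul_vVec hdet, mul_sub, Finset.sum_sub_distrib]
    rw [← sum_lower_mul_self (hs x), sq]
    congr 1
    · exact Finset.sum_congr rfl fun i _ => mul_comm _ _
    · conv_rhs => rw [pairing, Finset.sum_mul]
      exact Finset.sum_congr rfl fun i _ => by simp only [pairing]; ring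
  have h2 : ∑ i, lower a x y i * curlVec a b x y i = 0 := by
    rw [sum_lower_mul _ (hs x)]
    simp only [sum_metric_mul_curlVec hdet, sum_mul_curl_mul]
  have h3 : ∑ i, lower a x y i * ∑ k, ∑ m, riemannChristoffel a x i k m * y k * y m
      = 1 / 2 * ∑ n, y n * ∑ j, ∑ k, y j * y k * partialDeriv n (fun z => a z j k) x := by
    rw [sum_lower_mul _ (hs x)]
    simp only [sum_metric_mul_spray hs hdet, mul_sub, Finset.sum_sub_distrib]
    have h4 : ∑ n, y n * ∑ j, ∑ k, y j * y k * partialDeriv j (fun z => a z n k) x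
        = ∑ n, y n * ∑ j, ∑ k, y j * y k * partialDeriv n (fun z => a z j k) x := by
      simp only [Finset.mul_sum]
      rw [Finset.sum_comm]
      exact Finset.sum_congr rfl fun i _ => Finset.sum_congr rfl fun j _ =>
        Finset.sum_congr rfl fun k _ => by ring
    have h5 : ∑ n, y n * (1 / 2 * ∑ j, ∑ k, y j * y k * partialDeriv n (fun z => a z j k) x)
        = 1 / 2 * ∑ n, y n * ∑ j, ∑ k, y j * y k * partialDeriv n (fun z => a z j k) x := by
      rw [Finset.mul_sum (s := Finset.univ)]
      exact Finset.sum_congr rfl fun i _ => by ring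
    rw [h4, h5]
    ring
  rw [sum_mul_sprayForm, h1, h2, h3]
  ring

/-- The momentum equation of the geodesics, solved by the spray coefficients. -/
theorem sum_finslerMetric_mul_sprayForm (hg : g ∈ Set.Ioo (-2 : ℝ) 2)
    (hs : ∀ z i j, a z i j = a z j i) (hK : ∀ z w, K z w ^ 2 = finsleroidEnergy g a b z w)
    (ha : ∀ i j, DifferentiableAt ℝ (fun z => a z i j) x)
    (hb : ∀ i, DifferentiableAt ℝ (fun z => b z i) x) (hdet : IsUnit (a x).det)
    (hle : ∀ z y, pairing b z y ^ 2 ≤ normSq a z y) (h1 : ∑ i, b x i * raise a b x i = 1)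
    (h0 : 0 < normSq a x y - pairing b x y ^ 2) (n : Fin N) :
    ∑ i, finslerMetric K x y n i * sprayForm a b g (g ^ 2) (-g) x y i
      = fderiv ℝ (fun z => finsleroidMomentum g a b z y n) x y
        - 1 / 2 * partialDeriv n (fun z => finsleroidEnergy g a b z y) x := by
  have hq := Real.sqrt_pos.2 h0
  have hB := quad_pos hg (pairing b x y) hq
  have hmom : HasFDerivAt (fun z => finsleroidMomentum g a b z y n) _ x :=
    hasFDerivAt_momentum hg (hasFDerivAt_normSq_left ha y) (hasFDerivAt_pairing_left hb y)
      (hasFDerivAt_lower_left ha y n) (hb n).hasFDerivAt h0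
  have hen : HasFDerivAt (fun z => finsleroidEnergy g a b z y) _ x :=
    hasFDerivAt_energy hg (hasFDerivAt_normSq_left ha y) (hasFDerivAt_pairing_left hb y) h0
  have hσn : (∑ i, ∑ j, y j • y i • fderiv ℝ (fun z => a z i j) x) (EuclideanSpace.single n 1)
      = ∑ j, ∑ k, y j * y k * partialDeriv n (fun z => a z j k) x := by
    simp only [_root_.sum_apply, _root_.smul_apply, smul_eq_mul, partialDeriv]
    exact Finset.sum_congr rfl fun i _ => Finset.sum_congr rfl fun j _ => by ring
  have hσ : (∑ i, ∑ j, y j • y i • fderiv ℝ (fun z => a z i j) x) y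
      = ∑ n, y n * ∑ j, ∑ k, y j * y k * partialDeriv n (fun z => a z j k) x := by
    simp only [_root_.sum_apply, _root_.smul_apply, smul_eq_mul, ← sum_mul_partialDeriv,
      Finset.mul_sum]
    rw [Finset.sum_comm (f := fun n j => ∑ k, y n * (y j * y k *
      partialDeriv n (fun z => a z j k) x))]
    refine Finset.sum_congr rfl fun i _ => ?_
    rw [Finset.sum_comm]
    exact Finset.sum_congr rfl fun j _ => Finset.sum_congr rfl fun k _ => by ring
  have hβ : (∑ i, y i • fderiv ℝ (fun z => b z i) x) y
      = ∑ j, ∑ h, y j * y h * partialDeriv j (fun z => b z h) x := by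
    simp only [_root_.sum_apply, _root_.smul_apply, smul_eq_mul, ← sum_mul_partialDeriv,
      Finset.mul_sum]
    rw [Finset.sum_comm]
    exact Finset.sum_congr rfl fun j _ => Finset.sum_congr rfl fun k _ => by ring
  have hβn : (∑ i, y i • fderiv ℝ (fun z => b z i) x) (EuclideanSpace.single n 1)
      = ∑ k, partialDeriv n (fun z => b z k) x * y k := by
    simp only [_root_.sum_apply, _root_.smul_apply, smul_eq_mul, partialDeriv]
    exact Finset.sum_congr rfl fun i _ => mul_comm _ _
  have hα : (∑ i, y i • fderiv ℝ (fun z => a z n i) x) y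
      = ∑ j, ∑ k, y j * y k * partialDeriv j (fun z => a z n k) x := by
    simp only [_root_.sum_apply, _root_.smul_apply, smul_eq_mul, ← sum_mul_partialDeriv,
      Finset.mul_sum]
    rw [Finset.sum_comm]
    exact Finset.sum_congr rfl fun j _ => Finset.sum_congr rfl fun k _ => by ring
  have hb' : fderiv ℝ (fun z => b z n) x y = ∑ k, partialDeriv k (fun z => b z n) x * y k := by
    rw [← sum_mul_partialDeriv]
    exact Finset.sum_congr rfl fun i _ => mul_comm _ _
  have hf : ∑ k, curl a b x n k * y k = (∑ k, partialDeriv n (fun z => b z k) x * y k)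
      - ∑ k, partialDeriv k (fun z => b z n) x * y k := by
    simp only [curl_eq hs, sub_mul, Finset.sum_sub_distrib]
  -- The component of the Riemannian spray along `b` is the difference between the ordinary and the
  -- covariant derivative of `b` along `y`; it supplies the `T` that cancels the `c₁` term.
  have hbb : ∑ i, b x i * ∑ k, ∑ m, riemannChristoffel a x i k m * y k * y m
      = (∑ j, ∑ h, y j * y h * partialDeriv j (fun z => b z h) x)
        - ∑ j, ∑ h, y j * y h * nabla a b x j h := by
    rw [sum_mul_nabla]
    ring
  rw [hmom.fderiv, partialDeriv, hen.fderiv, sum_finslerMetric_mul hg (hs x) hK h0,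
    sum_lower_mul_sprayForm hs hdet h0, sum_mul_sprayForm, sum_mul_sprayForm, sum_b_mul_vVec h1,
    sum_b_mul_curlVec (hs x) (sum_raise_mul_nabla ha hb hs hdet hle h1), hbb,
    sum_metric_mul_vVec hdet, sum_metric_mul_curlVec hdet, hf, sum_metric_mul_spray hs hdet,
    qScalar_eq]
  simp only [_root_.add_apply, _root_.sub_apply, _root_.smul_apply, smul_eq_mul, hσ, hσn, hβ, hβn,
    hα, hb']
  -- The rest is a rational identity in which `T`, `s`, `q` and the weight are independent
  -- variables; `S²` no longer occurs, and only the definition of `B` is used.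
  generalize (∑ j, ∑ h, y j * y h * nabla a b x j h) = T
  generalize (∑ j, ∑ h, y h * raise a b x j * nabla a b x j h) = s
  generalize √(normSq a x y - pairing b x y ^ 2) = q at hq hB ⊢
  generalize weight g (pairing b x y) q = w
  field_simp
  unfold quad
  ring

theorem finslerSpray_eq_sum (i : Fin N) :
    finslerSpray K x y i = ∑ k, (finslerMetric K x y)⁻¹ i k
      * ∑ n, ∑ m, finslerChristoffelLow K x y n k m * y n * y m := by
  simp only [finslerSpray, finslerChristoffel, Finset.mul_sum, Finset.sum_mul]
  rw [Finset.sum_congr rfl fun k _ => Finset.sum_comm, Finset.sum_comm]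
  exact Finset.sum_congr rfl fun k _ => Finset.sum_congr rfl fun i _ =>
    Finset.sum_congr rfl fun j _ => by ring

theorem finslerSpray_eq_sprayForm (hg : g ∈ Set.Ioo (-2 : ℝ) 2)
    (hs : ∀ z i j, a z i j = a z j i) (hK : ∀ z w, K z w ^ 2 = finsleroidEnergy g a b z w)
    (ha : ∀ i j, DifferentiableAt ℝ (fun z => a z i j) x)
    (hb : ∀ i, DifferentiableAt ℝ (fun z => b z i) x) (hdet : IsUnit (a x).det)
    (hle : ∀ z y, pairing b z y ^ 2 ≤ normSq a z y) (h1 : ∑ i, b x i * raise a b x i = 1)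
    (h0 : 0 < normSq a x y - pairing b x y ^ 2) (i : Fin N) :
    finslerSpray K x y i = sprayForm a b g (g ^ 2) (-g) x y i := by
  have h := isUnit_det_finslerMetric hg (hs x) hK hdet h1 h0
  rw [finslerSpray_eq_sum]
  simp only [sum_finslerChristoffelLow hg hs hK ha hb h0,
    ← sum_finslerMetric_mul_sprayForm hg hs hK ha hb hdet hle h1 h0]
  have h2 : (finslerMetric K x y)⁻¹.mulVec ((finslerMetric K x y).mulVec
      (sprayForm a b g (g ^ 2) (-g) x y)) = sprayForm a b g (g ^ 2) (-g) x y := by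
    rw [Matrix.mulVec_mulVec, Matrix.nonsing_inv_mul _ h, Matrix.one_mulVec]
  exact congrFun h2 i

end

end Coord

/-! ### The metric function `K` in a chart -/

namespace FinsleroidFinslerSpace

open Finsleroid

variable {N : ℕ} {M : Type*} [TopologicalSpace M] [ChartedSpace (Coord N) M]
  [IsManifold (𝓡 N) ∞ M] (F : FinsleroidFinslerSpace N M)

theorem K_eq (p : M) (v : TangentSpace (𝓡 N) p) :
    F.K p v = √(quad (F.charge p) (F.b p v) (F.q p v))
      * Real.exp (1 / 2 * (F.charge p / modulus (F.charge p))
          * phase (F.charge p) (F.b p v) (F.q p v)) :=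
  rfl

/-- Squaring the root needs only `B ≥ 0`, so the identity holds for every vector, including those
with `q = 0`. -/
theorem K_sq (p : M) (v : TangentSpace (𝓡 N) p) :
    F.K p v ^ 2 = quad (F.charge p) (F.b p v) (F.q p v)
      * weight (F.charge p) (F.b p v) (F.q p v) := by
  rw [K_eq, mul_pow, Real.sq_sqrt (quad_nonneg (F.charge_mem p) _ _), weight, ← Real.exp_nat_mul]
  congr 2
  push_cast
  ring

theorem q_coordVec (e : OpenPartialHomeomorph M (Coord N)) (x y : Coord N) :
    F.q (e.symm x) (coordVec e x y)
      = √(Coord.normSq (F.coordA e) x y - Coord.pairing (F.coordB e) x y ^ 2) := by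
  rw [q, inner_coordVec, b_coordVec, Coord.normSq]

theorem coordK_sq {g : ℝ} (hg : ∀ p : M, F.charge p = g) (e : OpenPartialHomeomorph M (Coord N))
    (x y : Coord N) :
    F.coordK e x y ^ 2 = Coord.finsleroidEnergy g (F.coordA e) (F.coordB e) x y := by
  rw [coordK, K_sq, hg, b_coordVec, q_coordVec, Coord.finsleroidEnergy]

/-- Both radicands, `S² - b²` and `B`, are positive at the point, and the phase is smooth across `b
= 0`. -/
theorem contDiffAt_coordK {g : ℝ} (hg : ∀ p : M, F.charge p = g) (hg2 : g ∈ Set.Ioo (-2 : ℝ) 2)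
    {e : OpenPartialHomeomorph M (Coord N)} (he : e ∈ IsManifold.maximalAtlas (𝓡 N) ∞ M)
    {x : Coord N} (hx : x ∈ e.target) {y : Coord N}
    (h0 : 0 < Coord.normSq (F.coordA e) x y - Coord.pairing (F.coordB e) x y ^ 2) :
    ContDiffAt ℝ ∞ (fun z : Coord N × Coord N => F.coordK e z.1 z.2) (x, y) := by
  have hy : ∀ i, ContDiffAt ℝ ∞ (fun z : Coord N × Coord N => z.2 i) (x, y) := fun i =>
    ((EuclideanSpace.proj i : Coord N →L[ℝ] ℝ).contDiff.comp contDiff_snd).contDiffAt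
  have ha : ∀ i j, ContDiffAt ℝ ∞ (fun z : Coord N × Coord N => F.coordA e z.1 i j) (x, y) :=
    fun i j => ((F.contDiffOn_inner_coordVec he _ _).contDiffAt
      (e.open_target.mem_nhds hx)).comp (x, y) contDiffAt_fst
  have hb : ∀ i, ContDiffAt ℝ ∞ (fun z : Coord N × Coord N => F.coordB e z.1 i) (x, y) :=
    fun i => ((F.contDiffOn_b_coordVec he _).contDiffAt
      (e.open_target.mem_nhds hx)).comp (x, y) contDiffAt_fst
  have hσ : ContDiffAt ℝ ∞ (fun z : Coord N × Coord N =>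
      Coord.normSq (F.coordA e) z.1 z.2) (x, y) :=
    ContDiffAt.sum fun i _ => ContDiffAt.sum fun j _ => ((ha i j).mul (hy i)).mul (hy j)
  have hβ : ContDiffAt ℝ ∞ (fun z : Coord N × Coord N =>
      Coord.pairing (F.coordB e) z.1 z.2) (x, y) :=
    ContDiffAt.sum fun i _ => (hb i).mul (hy i)
  have hκ := (hσ.sub (hβ.pow 2)).sqrt h0.ne'
  have hq := Real.sqrt_pos.2 h0
  have hB := quad_pos hg2 (Coord.pairing (F.coordB e) x y) hq
  have hK : (fun z : Coord N × Coord N => F.coordK e z.1 z.2) = fun z =>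
      √(quad g (Coord.pairing (F.coordB e) z.1 z.2)
        √(Coord.normSq (F.coordA e) z.1 z.2 - Coord.pairing (F.coordB e) z.1 z.2 ^ 2))
      * Real.exp (1 / 2 * (g / modulus g) * phase g (Coord.pairing (F.coordB e) z.1 z.2)
        √(Coord.normSq (F.coordA e) z.1 z.2 - Coord.pairing (F.coordB e) z.1 z.2 ^ 2)) := by
    funext z
    rw [coordK, K_eq, hg, b_coordVec, q_coordVec]
  rw [hK]
  refine ContDiffAt.mul (ContDiffAt.sqrt ?_ hB.ne')
    (contDiffAt_const.mul (contDiffAt_phase hg2 hβ hκ hq)).exp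
  exact ((hβ.pow 2).add ((contDiffAt_const.mul hκ).mul hβ)).add (hκ.pow 2)

end FinsleroidFinslerSpace

theorem proposition3 {N : ℕ} {M : Type*} [TopologicalSpace M] [ChartedSpace (Coord N) M]
    [IsManifold (𝓡 N) ∞ M] (F : FinsleroidFinslerSpace N M)
    (g : ℝ) (hg : ∀ p : M, F.charge p = g)
    (e : OpenPartialHomeomorph M (Coord N)) (he : e ∈ IsManifold.maximalAtlas (𝓡 N) ∞ M)
    (x : Coord N) (hx : x ∈ e.target) (y : Coord N)
    (hq : 0 < Coord.qScalar (F.coordA e) (F.coordB e) x y) :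
    ContDiffAt ℝ ∞ (fun z : Coord N × Coord N => F.coordK e z.1 z.2) (x, y) ∧
    IsUnit (Coord.finslerMetric (F.coordK e) x y).det ∧
    ∀ i : Fin N,
      Coord.finslerSpray (F.coordK e) x y i
          = Coord.sprayForm (F.coordA e) (F.coordB e) g (g ^ 2) (-g) x y i ∧
      Coord.finslerSpray (F.coordK e) x y i
          = g * (1 / Coord.qScalar (F.coordA e) (F.coordB e) x y
                  * (∑ j, ∑ h, y j * y h * Coord.nabla (F.coordA e) (F.coordB e) x j h)
                + g * ∑ j, ∑ h, y h * Coord.raise (F.coordA e) (F.coordB e) x j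
                    * Coord.nabla (F.coordA e) (F.coordB e) x j h)
              * Coord.vVec (F.coordA e) (F.coordB e) x y i
            - g * Coord.qScalar (F.coordA e) (F.coordB e) x y
              * Coord.curlVec (F.coordA e) (F.coordB e) x y i
            + ∑ k, ∑ m, Coord.riemannChristoffel (F.coordA e) x i k m * y k * y m := by
  have h0 := Coord.sub_sq_pos_of_qScalar_pos hq
  have hg2 : g ∈ Set.Ioo (-2 : ℝ) 2 := hg (e.symm x) ▸ F.charge_mem (e.symm x)
  have hs := F.coordA_symm e
  have hK := F.coordK_sq hg e
  have hdet := F.isUnit_det_coordA he hx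
  have h1 := F.sum_coordB_mul_raise he hx
  have ha : ∀ i j, DifferentiableAt ℝ (fun z => F.coordA e z i j) x := fun i j =>
    ((F.contDiffOn_inner_coordVec he _ _).contDiffAt
      (e.open_target.mem_nhds hx)).differentiableAt (by simp)
  have hb : ∀ i, DifferentiableAt ℝ (fun z => F.coordB e z i) x := fun i =>
    ((F.contDiffOn_b_coordVec he _).contDiffAt
      (e.open_target.mem_nhds hx)).differentiableAt (by simp)
  -- Valid for all `z`, even outside the target of the chart: the coordinate vector is linear in `w`
  -- everywhere, and the inequality holds at every point of `M`.
  have hle : ∀ z w, Coord.pairing (F.coordB e) z w ^ 2 ≤ Coord.normSq (F.coordA e) z w := by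
    intro z w
    rw [← F.b_coordVec, Coord.normSq, ← F.inner_coordVec]
    exact F.b_sq_le _ _
  have hspray := Coord.finslerSpray_eq_sprayForm hg2 hs hK ha hb hdet hle h1 h0
  refine ⟨F.contDiffAt_coordK hg hg2 he hx h0,
    Coord.isUnit_det_finslerMetric hg2 (hs x) hK hdet h1 h0, fun i => ⟨hspray i, ?_⟩⟩
  rw [hspray i, Coord.sprayForm]
  ring
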